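/- For a complex number $q$ with $|q|<1$ let $$E_{2k}(q)=1-\frac{4k}{B_{2k}}\sum_{n\ge1}\sigma_{2k-1}(n)q^n,\qquad G_2(q)=2E_2(q^2)-E_2(q),$$ $$\theta_2(q)=\sum_{m\in\mathbb Z+\frac12}q^{m^2},\qquad \theta_3(q)=\sum_{m\in\mathbb Z}q^{m^2},\qquad \theta_4(q)=\sum_{m\in\mathbb Z}(-1)^mq^{m^2},$$ where $B_k$ are the Bernoulli numbers and $\sigma_k(n)=\sum_{d\mid n}d^k$, let $\Theta_{r,s}=\theta_2^{4r}\theta_3^{4s}+\theta_2^{4s}\theta_3^{4r}$, and let $D=q\frac{d}{dq}$. Define rational numbers $\widetilde c_c(\alpha,\beta,\gamma)$, for integers $\alpha,\beta,\gamma$, by $\widetilde c_c(\alpha,\beta,\gamma)=0$ if any argument is negative, $\widetilde c_c(0,0,0)=1$, and for all other $\alpha,\beta,\gamma\ge0$ $$\begin{aligned}\widetilde c_c(\alpha,\beta,\gamma)={}&\frac{2\alpha+4\beta+8\gamma-1}{24}\,\widetilde c_c(\alpha-1,\beta,\gamma)+\frac{24\gamma-8\beta+7}{24}\,\widetilde c_c(\alpha,\beta-1,\gamma)\\&-\frac{\alpha+1}{12}\,\widetilde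 c_c(\alpha+1,\beta,\gamma-1)+\frac{\beta+1}{6}\,\widetilde c_c(\alpha,\beta+1,\gamma-1)-\frac{4(\gamma+1)}{3}\,\widetilde c_c(\alpha,\beta-3,\gamma+1).\end{aligned}$$ Then for every positive integer $t$ and every $q$ with $|q|<1$ we have $G_2(q)=\Theta_{0,1}(q)$, $\theta_4(q)\neq0$, and $$\frac{D^t(\theta_4(q))}{\theta_4(q)}=\sum_{\substack{\alpha,\beta,\gamma\ge0\\ \alpha+\beta+2\gamma=t}}\widetilde c_c(\alpha,\beta,\gamma)\,E_2(q)^{\alpha}\,G_2(q)^{\beta}\,E_4(q)^{\gamma}.$$ -/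

import Mathlib

namespace QuasiTheta

noncomputable section

/-- The classical Eisenstein series `E_{2k}(q) = 1 - (4k / B_{2k}) ∑_{n ≥ 1} σ_{2k-1}(n) q^n`
(argument `k`, for `k ≥ 1`), as a function of the complex variable `q`, `|q| < 1`.
Thus `Eis 1` is `E_2` and `Eis 2` is `E_4`. -/
def Eis (k : ℕ) (q : ℂ) : ℂ :=
  1 - (4 * (k : ℂ) / ((bernoulli (2 * k) : ℚ) : ℂ)) *
    ∑' n : ℕ, ((ArithmeticFunction.sigma (2 * k - 1) (n + 1) : ℕ) : ℂ) * q ^ (n + 1)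

/-- `G_2(q) = 2 E_2(q²) - E_2(q)`. -/
def G2 (q : ℂ) : ℂ := 2 * Eis 1 (q ^ 2) - Eis 1 q

/-- `θ_2(q) = ∑_{m ∈ ℤ + 1/2} q^{m²}`, with the principal branch of the powers of `q`.
Only the fourth power of `θ_2` is used below, and it does not depend on the branch. -/
def theta2 (q : ℂ) : ℂ := ∑' m : ℤ, q ^ (((m : ℂ) + 1 / 2) ^ 2)

/-- `θ_3(q) = ∑_{m ∈ ℤ} q^{m²}`. -/
def theta3 (q : ℂ) : ℂ := ∑' m : ℤ, q ^ (m ^ 2).toNat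

/-- `θ_4(q) = ∑_{m ∈ ℤ} (-1)^m q^{m²}`. -/
def theta4 (q : ℂ) : ℂ := ∑' m : ℤ, (-1 : ℂ) ^ m * q ^ (m ^ 2).toNat

/-- `Θ_{r,s} = θ_2^{4r} θ_3^{4s} + θ_2^{4s} θ_3^{4r}`. -/
def Theta (r s : ℕ) (q : ℂ) : ℂ :=
  theta2 q ^ (4 * r) * theta3 q ^ (4 * s) + theta2 q ^ (4 * s) * theta3 q ^ (4 * r)

/-- The derivation `D = q d/dq`. -/
def D (f : ℂ → ℂ) : ℂ → ℂ := fun q => q * deriv f q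

/-- The rational numbers `c̃(α, β, γ)`: they vanish if an argument is negative,
`c̃(0, 0, 0) = 1`, and all other values are given by the five-term recursion. -/
def cTilde (α β γ : ℤ) : ℚ :=
  if α < 0 ∨ β < 0 ∨ γ < 0 then 0
  else if α = 0 ∧ β = 0 ∧ γ = 0 then 1
  else
    (2 * (α : ℚ) + 4 * β + 8 * γ - 1) / 24 * cTilde (α - 1) β γ
      + (24 * (γ : ℚ) - 8 * β + 7) / 24 * cTilde α (β - 1) γ
      - ((α : ℚ) + 1) / 12 * cTilde (α + 1) β (γ - 1)
      + ((β : ℚ) + 1) / 6 * cTilde α (β + 1) (γ - 1)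
      - 4 * ((γ : ℚ) + 1) / 3 * cTilde α (β - 3) (γ + 1)
termination_by (α + β + 2 * γ).toNat
decreasing_by all_goals omega

end

end QuasiTheta

/-!
Liouville's elementary method gives Besge's formula for `∑ σ(i) σ(n - i)`, which is Ramanujan's
`D E_2 = (E_2² - E_4) / 12`. Splitting the lattice `ℤ²` by parity gives the duplication formulas
`θ_3² + θ_4² = 2 θ_3(q²)²` and `θ_3 θ_4 = θ_4(q²)²`, with Jacobi's `θ_2⁴ = θ_3⁴ - θ_4⁴`, and Gauss's
product `θ_4 = ∏ (1 - qⁿ) / (1 + qⁿ)`, obtained from a finite form of the `q`-binomial theorem,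
gives `D θ_4 / θ_4 = (E_2(q) - E_2(q²)) / 12`.

The remaining identities are modular, but modularity can be replaced by one observation: a function
analytic at `0` with `f(0) = 0` and `f(q) = c(q) f(q²)`, `c` analytic, vanishes identically. Applied
three times it gives `4 (D θ_3 / θ_3 - D θ_4 / θ_4) = θ_3⁴ - θ_4⁴`, `G_2 = 2 θ_3⁴ - θ_4⁴` and
`E_4 = 16 θ_3⁸ - 16 θ_3⁴ θ_4⁴ + θ_4⁸`. Hence `D` preserves `θ_4 · ℚ[E_2, G_2, E_4]`, and comparing
coefficients of monomials in `D (θ_4 · P)` is the recursion for `c̃`.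
-/

namespace QuasiTheta

open Finset Filter Topology ArithmeticFunction.sigma

noncomputable section

/-- The positive solutions `((a, x), (b, y))` of `a x + b y = n`, over which Liouville's elementary
identities are summed. -/
def rectanglePairs (n : ℕ) : Finset ((ℕ × ℕ) × ℕ × ℕ) :=
  (antidiagonal n).biUnion fun ij => ij.1.divisorsAntidiagonal ×ˢ ij.2.divisorsAntidiagonal

lemma mem_rectanglePairs {n a x b y : ℕ} :
    ((a, x), b, y) ∈ rectanglePairs n ↔ 0 < a ∧ 0 < x ∧ 0 < b ∧ 0 < y ∧ a * x + b * y = n := by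
  simp only [rectanglePairs, mem_biUnion, HasAntidiagonal.mem_antidiagonal, mem_product,
    Nat.mem_divisorsAntidiagonal, Prod.exists, pos_iff_ne_zero]
  constructor
  · rintro ⟨i, j, rfl, ⟨rfl, hi⟩, rfl, hj⟩
    exact ⟨left_ne_zero_of_mul hi, right_ne_zero_of_mul hi, left_ne_zero_of_mul hj,
      right_ne_zero_of_mul hj, rfl⟩
  · rintro ⟨ha, hx, hb, hy, h⟩
    exact ⟨_, _, h, ⟨rfl, mul_ne_zero ha hx⟩, rfl, mul_ne_zero hb hy⟩

lemma sum_rectanglePairs {M : Type*} [AddCommMonoid M] (g : (ℕ × ℕ) × ℕ × ℕ → M) (n : ℕ) :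
    ∑ p ∈ rectanglePairs n, g p = ∑ ij ∈ antidiagonal n,
      ∑ u ∈ ij.1.divisorsAntidiagonal, ∑ v ∈ ij.2.divisorsAntidiagonal, g (u, v) := by
  rw [rectanglePairs, sum_biUnion]
  · simp only [sum_product]
  · intro ij _ kl _ hne
    refine disjoint_left.mpr fun p hp hp' => hne ?_
    simp only [mem_product, Nat.mem_divisorsAntidiagonal] at hp hp'
    exact Prod.ext (hp.1.1.symm.trans hp'.1.1) (hp.2.1.symm.trans hp'.2.1)

section Liouville

variable {M : Type*} {n : ℕ}

lemma sum_rectanglePairs_swap [AddCommMonoid M] (P : ℕ → ℕ → ℕ → ℕ → Prop)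
    [∀ a x b y, Decidable (P a x b y)] (g : ℕ → ℕ → ℕ → ℕ → M) :
    ∑ p ∈ rectanglePairs n with P p.1.1 p.1.2 p.2.1 p.2.2, g p.1.1 p.1.2 p.2.1 p.2.2 =
      ∑ p ∈ rectanglePairs n with P p.2.1 p.2.2 p.1.1 p.1.2, g p.2.1 p.2.2 p.1.1 p.1.2 := by
  refine sum_nbij' Prod.swap Prod.swap ?_ ?_ (fun _ _ => rfl) (fun _ _ => rfl) (fun _ _ => rfl) <;>
  · rintro ⟨⟨a, x⟩, b, y⟩ hp
    simp only [mem_filter, mem_rectanglePairs, Prod.swap_prod_mk] at hp ⊢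
    exact ⟨⟨hp.1.2.2.1, hp.1.2.2.2.1, hp.1.1, hp.1.2.1, by omega⟩, hp.2⟩

lemma sum_rectanglePairs_shear [AddCommMonoid M] (g : ℕ → ℕ → ℕ → ℕ → M) :
    ∑ p ∈ rectanglePairs n with p.2.1 < p.1.1, g (p.1.1 - p.2.1) p.1.2 p.2.1 (p.1.2 + p.2.2) =
      ∑ p ∈ rectanglePairs n with p.1.2 < p.2.2, g p.1.1 p.1.2 p.2.1 p.2.2 := by
  refine sum_nbij' (fun p => ((p.1.1 - p.2.1, p.1.2), p.2.1, p.1.2 + p.2.2))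
    (fun p => ((p.1.1 + p.2.1, p.1.2), p.2.1, p.2.2 - p.1.2)) ?_ ?_ ?_ ?_ (fun _ _ => rfl)
  · rintro ⟨⟨a, x⟩, b, y⟩ hp
    simp only [mem_filter, mem_rectanglePairs] at hp ⊢
    obtain ⟨⟨ha, hx, hb, hy, h⟩, hlt⟩ := hp
    obtain ⟨c, rfl⟩ := Nat.exists_eq_add_of_lt hlt
    refine ⟨⟨by omega, hx, hb, by omega, ?_⟩, by omega⟩
    rw [← h, add_assoc, Nat.add_sub_cancel_left]
    ring
  · rintro ⟨⟨a, x⟩, b, y⟩ hp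
    simp only [mem_filter, mem_rectanglePairs] at hp ⊢
    obtain ⟨⟨ha, hx, hb, hy, h⟩, hlt⟩ := hp
    obtain ⟨z, rfl⟩ := Nat.exists_eq_add_of_lt hlt
    refine ⟨⟨by omega, hx, hb, by omega, ?_⟩, by omega⟩
    rw [← h, add_assoc, Nat.add_sub_cancel_left]
    ring
  · rintro ⟨⟨a, x⟩, b, y⟩ hp
    have := (mem_filter.mp hp).2
    simp only [Prod.mk.injEq, and_true, true_and] at this ⊢
    omega
  · rintro ⟨⟨a, x⟩, b, y⟩ hp
    have := (mem_filter.mp hp).2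
    simp only [Prod.mk.injEq, and_true, true_and] at this ⊢
    omega

lemma sum_eq_add_sum_lt_add_sum_gt {ι : Type*} [AddCommMonoid M] (s : Finset ι) (u v : ι → ℕ)
    (g : ι → M) :
    ∑ i ∈ s, g i = ∑ i ∈ s with u i = v i, g i +
      (∑ i ∈ s with u i < v i, g i + ∑ i ∈ s with v i < u i, g i) := by
  simp only [sum_filter, ← sum_add_distrib]
  refine sum_congr rfl fun i _ => ?_
  rcases lt_trichotomy (u i) (v i) with h | h | h <;> simp [h, ne_of_lt, ne_of_gt, not_lt_of_gt]

lemma sum_rectanglePairs_sub [AddCommGroup M] {f : ℤ → M} (hf : ∀ m, f (-m) = f m) :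
    ∑ p ∈ rectanglePairs n, f (p.1.1 - p.2.1) =
      ∑ p ∈ rectanglePairs n with p.1.1 = p.2.1, f 0 +
        2 • ∑ p ∈ rectanglePairs n with p.1.2 < p.2.2, f p.1.1 := by
  have hswap := sum_rectanglePairs_swap (n := n) (fun a _ b _ => a < b) fun a _ b _ => f (a - b)
  have hshear := sum_rectanglePairs_shear (n := n) fun a _ _ _ => f a
  rw [sum_eq_add_sum_lt_add_sum_gt _ (fun p => p.1.1) (fun p => p.2.1), hswap, ← hshear, two_nsmul]
  congr 1
  · exact sum_congr rfl fun p hp => by rw [(mem_filter.mp hp).2, sub_self]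
  · congr 1 <;> refine sum_congr rfl fun p hp => ?_
    · rw [← hf, neg_sub, Nat.cast_sub (mem_filter.mp hp).2.le]
    · rw [Nat.cast_sub (mem_filter.mp hp).2.le]

lemma sum_rectanglePairs_add [AddCommMonoid M] (f : ℤ → M) :
    ∑ p ∈ rectanglePairs n, f (p.1.1 + p.2.1) =
      ∑ p ∈ rectanglePairs n with p.1.2 = p.2.2, f (p.1.1 + p.2.1) +
        2 • ∑ p ∈ rectanglePairs n with p.2.1 < p.1.1, f p.1.1 := by
  have hswap := sum_rectanglePairs_swap (n := n) (fun _ x _ y => y < x) fun a _ b _ => f (a + b)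
  have hshear := sum_rectanglePairs_shear (n := n) fun a _ b _ => f (a + b)
  rw [sum_eq_add_sum_lt_add_sum_gt _ (fun p => p.1.2) (fun p => p.2.2), hswap, two_nsmul]
  simp only [add_comm (Nat.cast (Prod.fst (Prod.snd _)) : ℤ)]
  rw [← hshear]
  congr 2 <;>
  · refine sum_congr rfl fun p hp => ?_
    rw [Nat.cast_sub (mem_filter.mp hp).2.le, sub_add_cancel]

theorem liouville_identity [AddCommGroup M] {f : ℤ → M} (hf : ∀ m, f (-m) = f m) :
    ∑ p ∈ rectanglePairs n, (f (p.1.1 - p.2.1) - f (p.1.1 + p.2.1)) =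
      ∑ p ∈ rectanglePairs n with p.1.1 = p.2.1, (f 0 + 2 • f p.1.1) -
        ∑ p ∈ rectanglePairs n with p.1.2 = p.2.2, (f (p.1.1 + p.2.1) + 2 • f p.1.1) := by
  have hcross : ∑ p ∈ rectanglePairs n with p.2.2 < p.1.2, f p.1.1 =
      ∑ p ∈ rectanglePairs n with p.1.1 < p.2.1, f p.1.1 := by
    rw [sum_rectanglePairs_swap (fun _ x _ y => y < x) fun a _ _ _ => f a,
      sum_rectanglePairs_swap (fun a _ b _ => a < b) fun a _ _ _ => f a]
    exact (sum_rectanglePairs_shear fun _ _ b _ => f b).symm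
  have hx := sum_eq_add_sum_lt_add_sum_gt (rectanglePairs n) (fun p => p.1.2) (fun p => p.2.2)
    fun p => f p.1.1
  have ha := sum_eq_add_sum_lt_add_sum_gt (rectanglePairs n) (fun p => p.1.1) (fun p => p.2.1)
    fun p => f p.1.1
  rw [hcross] at hx
  rw [hx] at ha
  simp only [sum_sub_distrib, sum_add_distrib, sum_nsmul, sum_rectanglePairs_sub hf,
    sum_rectanglePairs_add]
  linear_combination (norm := module) (2 : ℤ) • ha

end Liouville

lemma sum_rectanglePairs_heights_eq {M : Type*} [AddCommMonoid M] (g : ℕ → ℕ → ℕ → M) (n : ℕ) :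
    ∑ p ∈ rectanglePairs n with p.1.2 = p.2.2, g p.1.1 p.2.1 p.1.2 =
      ∑ u ∈ n.divisorsAntidiagonal, ∑ a ∈ Ioo 0 u.1, g a (u.1 - a) u.2 := by
  rw [sum_sigma']
  refine sum_nbij' (fun p => ⟨(p.1.1 + p.2.1, p.1.2), p.1.1⟩)
    (fun s => ((s.2, s.1.2), s.1.1 - s.2, s.1.2)) ?_ ?_ ?_ ?_ ?_
  · rintro ⟨⟨a, x⟩, b, y⟩ hp
    simp only [mem_filter, mem_rectanglePairs] at hp
    obtain ⟨⟨ha, hx, hb, -, rfl⟩, rfl⟩ := hp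
    simp only [mem_sigma, Nat.mem_divisorsAntidiagonal, mem_Ioo]
    refine ⟨⟨add_mul a b x, by positivity⟩, ha, by omega⟩
  · rintro ⟨⟨m, x⟩, a⟩ hs
    simp only [mem_sigma, Nat.mem_divisorsAntidiagonal, mem_Ioo] at hs
    obtain ⟨⟨rfl, hn⟩, ha, hlt⟩ := hs
    simp only [mem_filter, mem_rectanglePairs, and_true]
    refine ⟨ha, pos_iff_ne_zero.mpr (right_ne_zero_of_mul hn), by omega,
      pos_iff_ne_zero.mpr (right_ne_zero_of_mul hn), ?_⟩
    rw [← add_mul, Nat.add_sub_cancel' hlt.le]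
  · rintro ⟨⟨a, x⟩, b, y⟩ hp
    have := (mem_filter.mp hp).2
    simp_all
  · rintro ⟨⟨m, x⟩, a⟩ hs
    have := (mem_Ioo.mp (mem_sigma.mp hs).2).2
    simp [Nat.add_sub_cancel' this.le]
  · rintro ⟨⟨a, x⟩, b, y⟩ -
    simp

lemma sum_rectanglePairs_transpose {M : Type*} [AddCommMonoid M] (g : ℕ → ℕ → ℕ → M) (n : ℕ) :
    ∑ p ∈ rectanglePairs n with p.1.1 = p.2.1, g p.1.2 p.2.2 p.1.1 =
      ∑ p ∈ rectanglePairs n with p.1.2 = p.2.2, g p.1.1 p.2.1 p.1.2 := by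
  refine sum_nbij' (Prod.map Prod.swap Prod.swap) (Prod.map Prod.swap Prod.swap) ?_ ?_
    (fun _ _ => rfl) (fun _ _ => rfl) (fun _ _ => rfl) <;>
  · rintro ⟨⟨a, x⟩, b, y⟩ hp
    simp only [mem_filter, mem_rectanglePairs, Prod.map_apply, Prod.swap_prod_mk] at hp ⊢
    obtain ⟨⟨ha, hx, hb, hy, h⟩, he⟩ := hp
    exact ⟨⟨hx, ha, hy, hb, by rw [← h, mul_comm x, mul_comm y]⟩, he⟩

lemma sum_Ioo_zero_sq {m : ℕ} (hm : 0 < m) :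
    6 * ∑ a ∈ Ioo 0 m, (a : ℤ) ^ 2 = (m - 1) * m * (2 * m - 1) := by
  induction m, hm using Nat.le_induction with
  | base => simp only [Nat.succ_eq_add_one, zero_add, Nat.cast_one]; rfl
  | succ m hm ih =>
    have hIoo : Ioo 0 (m + 1) = insert m (Ioo 0 m) := by
      ext a
      simp only [mem_Ioo, mem_insert]
      omega
    rw [hIoo, sum_insert (by simp), mul_add, ih]
    push_cast
    ring

lemma sum_divisorsAntidiagonal_fst_pow (k n : ℕ) :
    ∑ u ∈ n.divisorsAntidiagonal, (u.1 : ℤ) ^ k = σ k n := by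
  rw [Nat.sum_divisorsAntidiagonal fun a _ => (a : ℤ) ^ k, ArithmeticFunction.sigma_apply]
  push_cast
  rfl

lemma sum_divisorsAntidiagonal_snd_pow (k n : ℕ) :
    ∑ u ∈ n.divisorsAntidiagonal, (u.2 : ℤ) ^ k = σ k n := by
  rw [Nat.sum_divisorsAntidiagonal' fun _ b => (b : ℤ) ^ k, ArithmeticFunction.sigma_apply]
  push_cast
  rfl

lemma sum_rectanglePairs_width_mul_width (n : ℕ) :
    ∑ p ∈ rectanglePairs n, (p.1.1 * p.2.1 : ℤ) =
      ∑ ij ∈ antidiagonal n, (σ 1 ij.1 * σ 1 ij.2 : ℤ) := by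
  rw [sum_rectanglePairs fun p => (p.1.1 * p.2.1 : ℤ)]
  refine sum_congr rfl fun ij _ => ?_
  simp only [← sum_divisorsAntidiagonal_fst_pow, sum_mul_sum, pow_one]

lemma sum_rectanglePairs_widths_eq_sq (n : ℕ) :
    ∑ p ∈ rectanglePairs n with p.1.1 = p.2.1, (p.1.1 : ℤ) ^ 2 = n * σ 1 n - σ 2 n := by
  rw [sum_rectanglePairs_transpose fun _ _ a => (a : ℤ) ^ 2,
    sum_rectanglePairs_heights_eq fun _ _ a => (a : ℤ) ^ 2]
  simp only [← sum_divisorsAntidiagonal_snd_pow, mul_sum, ← sum_sub_distrib, sum_const,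
    Nat.card_Ioo, nsmul_eq_mul]
  refine sum_congr rfl fun u hu => ?_
  obtain ⟨hmul, hn⟩ := Nat.mem_divisorsAntidiagonal.mp hu
  have hpos : 1 ≤ u.1 := Nat.one_le_iff_ne_zero.mpr (left_ne_zero_of_mul (hmul ▸ hn))
  rw [← hmul, Nat.sub_zero, Nat.cast_sub hpos]
  push_cast
  ring

lemma sum_rectanglePairs_heights_eq_sq (n : ℕ) :
    3 * (∑ p ∈ rectanglePairs n with p.1.2 = p.2.2,
      ((p.1.1 + p.2.1) ^ 2 + 2 * p.1.1 ^ 2) : ℤ) = (5 * σ 3 n - 6 * σ 2 n + σ 1 n : ℤ) := by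
  rw [sum_rectanglePairs_heights_eq fun a b _ => (a + b : ℤ) ^ 2 + 2 * (a : ℤ) ^ 2,
    ← sum_divisorsAntidiagonal_fst_pow 3, ← sum_divisorsAntidiagonal_fst_pow 2,
    ← sum_divisorsAntidiagonal_fst_pow 1, mul_sum, mul_sum, mul_sum, ← sum_sub_distrib,
    ← sum_add_distrib]
  refine sum_congr rfl fun u hu => ?_
  obtain ⟨hmul, hn⟩ := Nat.mem_divisorsAntidiagonal.mp hu
  have hpos : 0 < u.1 := pos_iff_ne_zero.mpr (left_ne_zero_of_mul (hmul ▸ hn))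
  have hconst : ∑ a ∈ Ioo 0 u.1, (a + (u.1 - a : ℕ) : ℤ) ^ 2 = (u.1 - 1) * u.1 ^ 2 := by
    rw [sum_congr rfl fun a ha => by
      rw [← Nat.cast_add, Nat.add_sub_cancel' (mem_Ioo.mp ha).2.le], sum_const, Nat.card_Ioo,
      nsmul_eq_mul, Nat.sub_zero, Nat.cast_pred hpos]
  rw [sum_add_distrib, hconst, ← mul_sum]
  linear_combination sum_Ioo_zero_sq hpos

theorem besge_formula (n : ℕ) :
    12 * ∑ ij ∈ antidiagonal n, (σ 1 ij.1 * σ 1 ij.2 : ℤ) =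
      5 * σ 3 n + (1 - 6 * n) * σ 1 n := by
  have h := liouville_identity (n := n) (f := fun m : ℤ => m ^ 2) fun m => neg_sq m
  have hl : ∀ p : (ℕ × ℕ) × ℕ × ℕ, ((p.1.1 - p.2.1 : ℤ) ^ 2 - (p.1.1 + p.2.1) ^ 2) =
      -4 * (p.1.1 * p.2.1) := fun p => by ring
  have hr := sum_rectanglePairs_heights_eq_sq n
  simp only [hl, ← mul_sum, sum_rectanglePairs_width_mul_width, zero_pow two_ne_zero, zero_add,
    nsmul_eq_mul, Nat.cast_ofNat, sum_rectanglePairs_widths_eq_sq] at h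
  linear_combination -3 * h + hr

section Derivation

variable {f g : ℂ → ℂ} {q : ℂ}

lemma D_add (hf : DifferentiableAt ℂ f q) (hg : DifferentiableAt ℂ g q) :
    D (fun z => f z + g z) q = D f q + D g q := by
  simp only [D, deriv_fun_add hf hg, mul_add]

lemma D_sub (hf : DifferentiableAt ℂ f q) (hg : DifferentiableAt ℂ g q) :
    D (fun z => f z - g z) q = D f q - D g q := by
  simp only [D, deriv_fun_sub hf hg, mul_sub]

lemma D_const_mul (c : ℂ) (f : ℂ → ℂ) (q : ℂ) : D (fun z => c * f z) q = c * D f q := by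
  simp only [D, deriv_const_mul_field', mul_left_comm]

lemma D_mul (hf : DifferentiableAt ℂ f q) (hg : DifferentiableAt ℂ g q) :
    D (fun z => f z * g z) q = D f q * g q + f q * D g q := by
  simp only [D, deriv_fun_mul hf hg]
  ring

lemma D_sum {ι : Type*} {s : Finset ι} {F : ι → ℂ → ℂ}
    (hF : ∀ i ∈ s, DifferentiableAt ℂ (F i) q) :
    D (fun z => ∑ i ∈ s, F i z) q = ∑ i ∈ s, D (F i) q := by
  simp only [D, deriv_fun_sum hF, mul_sum]

lemma D_pow (hf : DifferentiableAt ℂ f q) (n : ℕ) :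
    D (fun z => f z ^ n) q = n * f q ^ (n - 1) * D f q := by
  simp only [D, deriv_fun_pow hf n, mul_left_comm q]

lemma D_comp_sq (hf : DifferentiableAt ℂ f (q ^ 2)) :
    D (fun z => f (z ^ 2)) q = 2 * D f (q ^ 2) := by
  have h := hf.hasDerivAt.comp q (hasDerivAt_pow 2 q)
  simp only [D]
  rw [show deriv (fun z => f (z ^ 2)) q = _ from h.deriv]
  push_cast
  ring

lemma eventually_norm_lt_one (hq : ‖q‖ < 1) : ∀ᶠ z in 𝓝 q, ‖z‖ < 1 :=
  continuous_norm.continuousAt.eventually_lt continuousAt_const hq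

lemma D_congr (hfg : ∀ z, ‖z‖ < 1 → f z = g z) (hq : ‖q‖ < 1) : D f q = D g q := by
  rw [D, D, EventuallyEq.deriv_eq ((eventually_norm_lt_one hq).mono hfg)]

lemma norm_sq_lt_one (hq : ‖q‖ < 1) : ‖q ^ 2‖ < 1 := by
  rw [norm_pow]
  exact pow_lt_one₀ (norm_nonneg _) hq two_ne_zero

end Derivation

section Series

variable {ι : Type*} {c : ι → ℂ} {e : ι → ℕ}

lemma summable_norm_mul_pow_of_nonneg (h : ∀ q : ℂ, ‖q‖ < 1 → Summable fun i => ‖c i * q ^ e i‖)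
    {r : ℝ} (hr : 0 ≤ r) (hr1 : r < 1) : Summable fun i => ‖c i‖ * r ^ e i := by
  simpa [abs_of_nonneg hr] using h r (by simpa [abs_of_nonneg hr] using hr1)

lemma norm_mul_pow_le {r : ℝ} {z : ℂ} (hz : z ∈ Metric.ball 0 r) (i : ι) :
    ‖c i * z ^ e i‖ ≤ ‖c i‖ * r ^ e i := by
  rw [norm_mul, norm_pow]
  gcongr
  exact (mem_ball_zero_iff.mp hz).le

lemma analyticAt_tsum_mul_pow (h : ∀ q : ℂ, ‖q‖ < 1 → Summable fun i => ‖c i * q ^ e i‖)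
    {q : ℂ} (hq : ‖q‖ < 1) : AnalyticAt ℂ (fun z => ∑' i, c i * z ^ e i) q := by
  obtain ⟨r, hqr, hr1⟩ := exists_between hq
  have hdiff : DifferentiableOn ℂ (fun z => ∑' i, c i * z ^ e i) (Metric.ball 0 r) :=
    Complex.differentiableOn_tsum_of_summable_norm
      (summable_norm_mul_pow_of_nonneg h ((norm_nonneg q).trans hqr.le) hr1)
      (fun i => by fun_prop) Metric.isOpen_ball fun i z hz => norm_mul_pow_le hz i
  exact hdiff.analyticAt (Metric.isOpen_ball.mem_nhds (mem_ball_zero_iff.mpr hqr))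

lemma hasSum_D_tsum_mul_pow (h : ∀ q : ℂ, ‖q‖ < 1 → Summable fun i => ‖c i * q ^ e i‖)
    {q : ℂ} (hq : ‖q‖ < 1) :
    HasSum (fun i => e i * (c i * q ^ e i)) (D (fun z => ∑' i, c i * z ^ e i) q) := by
  obtain ⟨r, hqr, hr1⟩ := exists_between hq
  have hderiv := Complex.hasSum_deriv_of_summable_norm
    (summable_norm_mul_pow_of_nonneg h ((norm_nonneg q).trans hqr.le) hr1)
    (F := fun i z => c i * z ^ e i) (fun i => by fun_prop) Metric.isOpen_ball
    (fun i z hz => norm_mul_pow_le hz i) (mem_ball_zero_iff.mpr hqr)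
  refine (hderiv.mul_left q).congr_fun fun i => ?_
  simp only [deriv_const_mul_field', deriv_pow_field]
  rcases Nat.eq_zero_or_pos (e i) with h0 | hpos
  · simp [h0]
  · rw [← Nat.sub_add_cancel hpos, pow_succ, Nat.add_sub_cancel]
    push_cast
    ring

end Series

/-- The Lambert series `∑_{n ≥ 1} σ_k(n) qⁿ`. The `n = 0` term of the sum vanishes because
`σ k 0 = 0`. -/
def divisorSeries (k : ℕ) (q : ℂ) : ℂ := ∑' n : ℕ, (σ k n : ℂ) * q ^ n

lemma summable_norm_divisorSeries (k : ℕ) (q : ℂ) (hq : ‖q‖ < 1) :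
    Summable fun n : ℕ => ‖(σ k n : ℂ) * q ^ n‖ := by
  refine Summable.of_nonneg_of_le (fun _ => norm_nonneg _) (fun n => ?_)
    (summable_norm_pow_mul_geometric_of_norm_lt_one (k + 1) hq)
  rw [norm_mul, norm_mul, norm_pow, norm_pow, Complex.norm_natCast, Complex.norm_natCast]
  gcongr
  exact_mod_cast ArithmeticFunction.sigma_le_pow_succ k n

lemma divisorSeries_zero (k : ℕ) : divisorSeries k 0 = 0 := by
  rw [divisorSeries, tsum_eq_single 0 fun n hn => by simp [hn]]
  simp

lemma analyticAt_divisorSeries (k : ℕ) {q : ℂ} (hq : ‖q‖ < 1) :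
    AnalyticAt ℂ (divisorSeries k) q :=
  analyticAt_tsum_mul_pow (summable_norm_divisorSeries k) hq

lemma tsum_sigma_succ (k : ℕ) {q : ℂ} (hq : ‖q‖ < 1) :
    ∑' n : ℕ, (σ k (n + 1) : ℂ) * q ^ (n + 1) = divisorSeries k q := by
  rw [divisorSeries, (summable_norm_divisorSeries k q hq).of_norm.tsum_eq_zero_add]
  simp

lemma Eis_one_eq {q : ℂ} (hq : ‖q‖ < 1) : Eis 1 q = 1 - 24 * divisorSeries 1 q := by
  rw [Eis, ← tsum_sigma_succ 1 hq, mul_one, bernoulli_two]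
  norm_num

lemma Eis_two_eq {q : ℂ} (hq : ‖q‖ < 1) : Eis 2 q = 1 + 240 * divisorSeries 3 q := by
  have hbernoulli : bernoulli (2 * 2) = -1 / 30 := by
    rw [bernoulli_eq_bernoulli'_of_ne_one (by norm_num)]
    exact bernoulli'_four
  rw [Eis, ← tsum_sigma_succ 3 hq, hbernoulli]
  norm_num

lemma analyticAt_Eis_one {q : ℂ} (hq : ‖q‖ < 1) : AnalyticAt ℂ (Eis 1) q :=
  (analyticAt_const.sub (analyticAt_const.mul (analyticAt_divisorSeries 1 hq))).congr
    ((eventually_norm_lt_one hq).mono fun _ hz => (Eis_one_eq hz).symm)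

lemma analyticAt_Eis_two {q : ℂ} (hq : ‖q‖ < 1) : AnalyticAt ℂ (Eis 2) q :=
  (analyticAt_const.add (analyticAt_const.mul (analyticAt_divisorSeries 3 hq))).congr
    ((eventually_norm_lt_one hq).mono fun _ hz => (Eis_two_eq hz).symm)

lemma divisorSeries_one_sq {q : ℂ} (hq : ‖q‖ < 1) :
    12 * divisorSeries 1 q ^ 2 =
      5 * divisorSeries 3 q + divisorSeries 1 q - 6 * D (divisorSeries 1) q := by
  have hsum := fun k => (summable_norm_divisorSeries k q hq).of_norm.hasSum
  have hD := hasSum_D_tsum_mul_pow (summable_norm_divisorSeries 1) hq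
  have hright := (((hsum 3).mul_left 5).add (hsum 1)).sub (hD.mul_left 6)
  refine Eq.trans ?_ hright.tsum_eq
  rw [sq, divisorSeries, tsum_mul_tsum_eq_tsum_sum_antidiagonal_of_summable_norm
    (summable_norm_divisorSeries 1 q hq) (summable_norm_divisorSeries 1 q hq), ← tsum_mul_left]
  refine tsum_congr fun n => ?_
  have hbesge := congrArg (Int.cast : ℤ → ℂ) (besge_formula n)
  push_cast at hbesge
  have hpow : ∑ ij ∈ antidiagonal n, (σ 1 ij.1 * q ^ ij.1) * (σ 1 ij.2 * q ^ ij.2) =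
      (∑ ij ∈ antidiagonal n, (σ 1 ij.1 * σ 1 ij.2 : ℂ)) * q ^ n := by
    rw [sum_mul]
    refine sum_congr rfl fun ij hij => ?_
    rw [← HasAntidiagonal.mem_antidiagonal.mp hij, pow_add]
    ring
  rw [hpow]
  linear_combination q ^ n * hbesge

theorem D_Eis_one {q : ℂ} (hq : ‖q‖ < 1) : D (Eis 1) q = (Eis 1 q ^ 2 - Eis 2 q) / 12 := by
  have hdiff := (analyticAt_divisorSeries 1 hq).differentiableAt
  have hD : D (Eis 1) q = -24 * D (divisorSeries 1) q := by
    rw [D_congr (fun z hz => Eis_one_eq hz) hq, D_sub (by fun_prop) (hdiff.const_mul 24),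
      D_const_mul]
    simp [D]
  rw [hD, Eis_one_eq hq, Eis_two_eq hq]
  linear_combination -4 * divisorSeries_one_sq hq

section UnitDisc

variable {f g : ℂ → ℂ}

lemma isPreconnected_unitDisc : IsPreconnected (Metric.ball (0 : ℂ) 1) :=
  (convex_ball 0 1).isPreconnected

lemma eq_zero_or_eq_zero_of_mul_eq_zero_unitDisc (hf : ∀ q, ‖q‖ < 1 → AnalyticAt ℂ f q)
    (hg : ∀ q, ‖q‖ < 1 → AnalyticAt ℂ g q) (hfg : ∀ q, ‖q‖ < 1 → f q * g q = 0) :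
    (∀ q, ‖q‖ < 1 → f q = 0) ∨ ∀ q, ‖q‖ < 1 → g q = 0 := by
  simpa only [mem_ball_zero_iff] using AnalyticOnNhd.eq_zero_or_eq_zero_of_mul_eq_zero
    (U := Metric.ball 0 1) (fun q hq => hf q (mem_ball_zero_iff.mp hq))
    (fun q hq => hg q (mem_ball_zero_iff.mp hq)) (fun q hq => hfg q (mem_ball_zero_iff.mp hq))
    isPreconnected_unitDisc

lemma eq_of_sq_eq_sq_unitDisc (hf : ∀ q, ‖q‖ < 1 → AnalyticAt ℂ f q)
    (hg : ∀ q, ‖q‖ < 1 → AnalyticAt ℂ g q) (hsq : ∀ q, ‖q‖ < 1 → f q ^ 2 = g q ^ 2)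
    (h0 : f 0 = g 0) (hne : f 0 ≠ 0) {q : ℂ} (hq : ‖q‖ < 1) : f q = g q := by
  rcases eq_zero_or_eq_zero_of_mul_eq_zero_unitDisc (fun z hz => (hf z hz).sub (hg z hz))
    (fun z hz => (hf z hz).add (hg z hz))
    (fun z hz => by simp only [Pi.sub_apply, Pi.add_apply]; linear_combination hsq z hz) with h | h
  · exact sub_eq_zero.mp (h q hq)
  · refine absurd (h 0 (by simp)) ?_
    simpa [← h0, ← two_mul] using hne

lemma analyticAt_comp_sq {q : ℂ} (hf : AnalyticAt ℂ f (q ^ 2)) :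
    AnalyticAt ℂ (fun z => f (z ^ 2)) q :=
  AnalyticAt.fun_comp (f := fun z => z ^ 2) hf (by fun_prop)

lemma analyticOrderAt_comp_sq (hf : AnalyticAt ℂ f 0) :
    analyticOrderAt (fun z => f (z ^ 2)) 0 = analyticOrderAt f 0 * 2 := by
  have hsq : (fun z : ℂ => z ^ 2 - 0 ^ 2) = (fun z => z - 0) ^ 2 := by
    ext z
    simp
  have h := AnalyticAt.analyticOrderAt_comp (f := f) (g := fun z : ℂ => z ^ 2) (z₀ := 0)
    (by simpa using hf) (by fun_prop)
  rw [hsq, analyticOrderAt_centeredMonomial, zero_pow two_ne_zero] at h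
  exact h

/- If `f` vanished at `0` to a finite order `k > 0`, the right-hand side would vanish to order at
least `2k`. -/
lemma eq_zero_of_eq_mul_comp_sq {c : ℂ → ℂ} (hf : ∀ q, ‖q‖ < 1 → AnalyticAt ℂ f q)
    (hc : AnalyticAt ℂ c 0) (h0 : f 0 = 0) (hfc : ∀ᶠ z in 𝓝 0, f z = c z * f (z ^ 2))
    {q : ℂ} (hq : ‖q‖ < 1) : f q = 0 := by
  have hf0 := hf 0 (by simp)
  have hcomp : AnalyticAt ℂ (fun z => f (z ^ 2)) 0 := analyticAt_comp_sq (by simpa using hf0)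
  have horder : analyticOrderAt f 0 = analyticOrderAt c 0 + analyticOrderAt f 0 * 2 := by
    rw [← analyticOrderAt_comp_sq hf0, ← analyticOrderAt_mul hc hcomp]
    exact analyticOrderAt_congr hfc
  have htop : analyticOrderAt f 0 = ⊤ := by
    have hne := hf0.analyticOrderAt_ne_zero.mpr h0
    by_contra hfin
    lift analyticOrderAt f 0 to ℕ using hfin with k
    generalize analyticOrderAt c 0 = m at horder
    cases m with
    | top => simp at horder
    | coe m =>
      norm_cast at horder hne
      omega
  exact AnalyticOnNhd.eqOn_zero_of_preconnected_of_eventuallyEq_zero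
    (fun z hz => hf z (mem_ball_zero_iff.mp hz)) isPreconnected_unitDisc
    (Metric.mem_ball_self one_pos) (analyticOrderAt_eq_top.mp htop) (mem_ball_zero_iff.mpr hq)

end UnitDisc

section Lattice

/-- Pairs of integers, split by the parity of their sum: `(a, b)` is sent to `(a + b, a - b)` or to
`(a + b + 1, a - b)`. -/
def parityMap : (ℤ × ℤ) ⊕ (ℤ × ℤ) → ℤ × ℤ :=
  Sum.elim (fun p => (p.1 + p.2, p.1 - p.2)) (fun p => (p.1 + p.2 + 1, p.1 - p.2))

lemma parityMap_bijective : Function.Bijective parityMap := by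
  constructor
  · rintro (⟨a, b⟩ | ⟨a, b⟩) (⟨c, d⟩ | ⟨c, d⟩) h <;>
      simp only [parityMap, Sum.elim_inl, Sum.elim_inr, Prod.mk.injEq] at h <;>
      simp only [Sum.inl.injEq, Sum.inr.injEq, Prod.mk.injEq, reduceCtorEq] <;> omega
  · rintro ⟨m, n⟩
    rcases Int.even_or_odd' (m + n) with ⟨k, hk | hk⟩
    · exact ⟨Sum.inl (k, m - k), Prod.ext (add_sub_cancel k m) (by simp [parityMap]; omega)⟩
    · exact ⟨Sum.inr (k, m - 1 - k), by simp only [parityMap, Sum.elim_inr, Prod.mk.injEq]; omega⟩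

lemma tsum_eq_tsum_parity {f : ℤ × ℤ → ℂ} (hf : Summable f) :
    ∑' p, f p = ∑' p : ℤ × ℤ, f (p.1 + p.2, p.1 - p.2) +
      ∑' p : ℤ × ℤ, f (p.1 + p.2 + 1, p.1 - p.2) := by
  let e := Equiv.ofBijective parityMap parityMap_bijective
  have hs : Summable (f ∘ e) := e.summable_iff.mpr hf
  rw [← e.tsum_eq]
  exact Summable.tsum_sum (hs.comp_injective Sum.inl_injective)
    (hs.comp_injective Sum.inr_injective)

lemma tsum_pow_mul_tsum_pow {q : ℂ} {d e : ℤ → ℕ} (hd : Summable fun m => ‖q ^ d m‖)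
    (he : Summable fun m => ‖q ^ e m‖) :
    (∑' m, q ^ d m) * ∑' m, q ^ e m = ∑' p : ℤ × ℤ, q ^ (d p.1 + e p.2) := by
  simp only [tsum_mul_tsum_of_summable_norm hd he, pow_add]

lemma tsum_pow_sq_eq_tsum_parity {q : ℂ} {e : ℤ → ℕ} (he : Summable fun m => ‖q ^ e m‖) :
    (∑' m, q ^ e m) ^ 2 = ∑' p : ℤ × ℤ, q ^ (e (p.1 + p.2) + e (p.1 - p.2)) +
      ∑' p : ℤ × ℤ, q ^ (e (p.1 + p.2 + 1) + e (p.1 - p.2)) := by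
  rw [sq, tsum_pow_mul_tsum_pow he he, tsum_eq_tsum_parity]
  simpa only [pow_add] using summable_mul_of_summable_norm he he

end Lattice

section Theta

variable {q : ℂ}

/-- The series `∑_{m ∈ ℤ} q^{m² + m} = q^{-1/4} θ_2(q)`, which has no branch point. -/
def theta2Core (q : ℂ) : ℂ := ∑' m : ℤ, q ^ (m ^ 2 + m).toNat

lemma sq_add_self_nonneg (m : ℤ) : 0 ≤ m ^ 2 + m := by
  rcases le_or_gt 0 m with h | h <;> nlinarith

lemma natCast_toNat_sq (m : ℤ) : ((m ^ 2).toNat : ℤ) = m ^ 2 := Int.toNat_of_nonneg (sq_nonneg m)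

lemma natCast_toNat_sq_add_self (m : ℤ) : ((m ^ 2 + m).toNat : ℤ) = m ^ 2 + m :=
  Int.toNat_of_nonneg (sq_add_self_nonneg m)

lemma summable_norm_pow_of_natAbs_le {e : ℤ → ℕ} (he : ∀ m, m.natAbs ≤ e m + 1) (hq : ‖q‖ < 1) :
    Summable fun m : ℤ => ‖q ^ e m‖ := by
  obtain ⟨r, hqr, hr1⟩ := exists_between hq
  have hr0 : 0 < r := (norm_nonneg _).trans_lt hqr
  have hs : Summable fun m : ℤ => r ^ m.natAbs := by
    apply Summable.of_nat_of_neg <;> simpa using summable_geometric_of_lt_one hr0.le hr1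
  refine Summable.of_nonneg_of_le (fun _ => norm_nonneg _) (fun m => ?_) (hs.mul_left r⁻¹)
  rw [norm_pow, le_inv_mul_iff₀ hr0]
  calc r * ‖q‖ ^ e m ≤ r * r ^ e m := by gcongr
    _ = r ^ (e m + 1) := (pow_succ' r _).symm
    _ ≤ r ^ m.natAbs := pow_le_pow_of_le_one hr0.le hr1.le (he m)

lemma summable_norm_theta3 (hq : ‖q‖ < 1) : Summable fun m : ℤ => ‖q ^ (m ^ 2).toNat‖ :=
  summable_norm_pow_of_natAbs_le (fun m => by
    zify
    rw [natCast_toNat_sq]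
    nlinarith [abs_nonneg m, sq_abs m]) hq

lemma summable_norm_theta2Core (hq : ‖q‖ < 1) : Summable fun m : ℤ => ‖q ^ (m ^ 2 + m).toNat‖ :=
  summable_norm_pow_of_natAbs_le (fun m => by
    zify
    rw [natCast_toNat_sq_add_self]
    rcases abs_cases m with h | h <;> nlinarith) hq

lemma analyticAt_tsum_pow {e : ℤ → ℕ} (h : ∀ q : ℂ, ‖q‖ < 1 → Summable fun m => ‖q ^ e m‖)
    (hq : ‖q‖ < 1) : AnalyticAt ℂ (fun z => ∑' m, z ^ e m) q := by
  simpa only [one_mul] using analyticAt_tsum_mul_pow (c := fun _ => 1) (by simpa using h) hq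

lemma analyticAt_theta3 (hq : ‖q‖ < 1) : AnalyticAt ℂ theta3 q :=
  analyticAt_tsum_pow (fun _ => summable_norm_theta3) hq

lemma analyticAt_theta2Core (hq : ‖q‖ < 1) : AnalyticAt ℂ theta2Core q :=
  analyticAt_tsum_pow (fun _ => summable_norm_theta2Core) hq

lemma theta4_eq_theta3_neg (q : ℂ) : theta4 q = theta3 (-q) := by
  refine tsum_congr fun m => ?_
  rw [neg_pow, ← zpow_natCast (-1 : ℂ) (m ^ 2).toNat, natCast_toNat_sq]
  congr 1
  rcases Int.even_or_odd m with hm | hm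
  · rw [hm.neg_one_zpow, (hm.pow_of_ne_zero two_ne_zero).neg_one_zpow]
  · rw [hm.neg_one_zpow, hm.pow.neg_one_zpow]

lemma analyticAt_theta4 (hq : ‖q‖ < 1) : AnalyticAt ℂ theta4 q := by
  rw [show theta4 = fun z => theta3 (-z) from funext theta4_eq_theta3_neg]
  exact AnalyticAt.fun_comp (analyticAt_theta3 (by rwa [norm_neg])) (by fun_prop)

lemma theta3_zero : theta3 0 = 1 := by
  refine (tsum_eq_single 0 fun m hm => zero_pow ?_).trans (by simp)
  have : 0 < m ^ 2 := by positivity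
  omega

lemma theta4_zero : theta4 0 = 1 := by rw [theta4_eq_theta3_neg, neg_zero, theta3_zero]

lemma theta2Core_zero : theta2Core 0 = 2 := by
  refine (tsum_eq_sum (s := {0, -1}) fun m hm => zero_pow fun h => hm ?_).trans (by norm_num)
  have hm0 := natCast_toNat_sq_add_self m
  rw [h] at hm0
  have hprod : m * (m + 1) = 0 := by linear_combination -hm0
  simpa [eq_neg_iff_add_eq_zero] using hprod

lemma theta3_sq (hq : ‖q‖ < 1) :
    theta3 q ^ 2 = theta3 (q ^ 2) ^ 2 + q * theta2Core (q ^ 2) ^ 2 := by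
  have hq2 := norm_sq_lt_one hq
  simp only [theta3, theta2Core]
  rw [tsum_pow_sq_eq_tsum_parity (summable_norm_theta3 hq), sq (∑' m : ℤ, (q ^ 2) ^ (m ^ 2).toNat),
    tsum_pow_mul_tsum_pow (summable_norm_theta3 hq2) (summable_norm_theta3 hq2), sq (∑' m : ℤ, _),
    tsum_pow_mul_tsum_pow (summable_norm_theta2Core hq2) (summable_norm_theta2Core hq2),
    ← tsum_mul_left]
  congr 1 <;> refine tsum_congr fun p => ?_
  · rw [← pow_mul]
    congr 1
    zify
    simp only [natCast_toNat_sq]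
    ring
  · rw [← pow_mul, ← pow_succ']
    congr 1
    zify
    simp only [natCast_toNat_sq, natCast_toNat_sq_add_self]
    ring

lemma theta2Core_sq (hq : ‖q‖ < 1) :
    theta2Core q ^ 2 = 2 * theta2Core (q ^ 2) * theta3 (q ^ 2) := by
  have hq2 := norm_sq_lt_one hq
  have hodd : ∑' p : ℤ × ℤ, (q ^ 2) ^ ((p.1 ^ 2).toNat + (p.2 ^ 2 + p.2).toNat) =
      ∑' p : ℤ × ℤ, q ^ (((p.1 + p.2 + 1) ^ 2 + (p.1 + p.2 + 1)).toNat +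
        ((p.1 - p.2) ^ 2 + (p.1 - p.2)).toNat) := by
    rw [← ((Equiv.addRight (1 : ℤ)).prodCongr (Equiv.refl ℤ)).tsum_eq]
    refine tsum_congr fun p => ?_
    rw [← pow_mul]
    congr 1
    zify
    simp only [natCast_toNat_sq, natCast_toNat_sq_add_self, Equiv.prodCongr_apply, Prod.map_fst,
      Equiv.coe_addRight, Prod.map_snd, Equiv.refl_apply]
    ring
  have heven : ∑' p : ℤ × ℤ, (q ^ 2) ^ ((p.1 ^ 2 + p.1).toNat + (p.2 ^ 2).toNat) =
      ∑' p : ℤ × ℤ, q ^ (((p.1 + p.2) ^ 2 + (p.1 + p.2)).toNat +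
        ((p.1 - p.2) ^ 2 + (p.1 - p.2)).toNat) := by
    refine tsum_congr fun p => ?_
    rw [← pow_mul]
    congr 1
    zify
    simp only [natCast_toNat_sq, natCast_toNat_sq_add_self]
    ring
  simp only [theta3, theta2Core]
  rw [tsum_pow_sq_eq_tsum_parity (summable_norm_theta2Core hq), ← heven, ← hodd,
    ← tsum_pow_mul_tsum_pow (summable_norm_theta2Core hq2) (summable_norm_theta3 hq2),
    ← tsum_pow_mul_tsum_pow (summable_norm_theta3 hq2) (summable_norm_theta2Core hq2)]
  ring

lemma theta4_sq (hq : ‖q‖ < 1) :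
    theta4 q ^ 2 = theta3 (q ^ 2) ^ 2 - q * theta2Core (q ^ 2) ^ 2 := by
  have h := theta3_sq (q := -q) (by rwa [norm_neg])
  rw [theta4_eq_theta3_neg, h, neg_sq]
  ring

lemma theta3_pow_four_sub_theta4_pow_four (hq : ‖q‖ < 1) :
    theta3 q ^ 4 - theta4 q ^ 4 = q * theta2Core q ^ 4 := by
  linear_combination (theta3 q ^ 2 + theta3 (q ^ 2) ^ 2 + q * theta2Core (q ^ 2) ^ 2) *
    theta3_sq hq - (theta4 q ^ 2 + theta3 (q ^ 2) ^ 2 - q * theta2Core (q ^ 2) ^ 2) * theta4_sq hq -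
    q * (theta2Core q ^ 2 + 2 * theta2Core (q ^ 2) * theta3 (q ^ 2)) * theta2Core_sq hq

lemma theta2_eq (hq : q ≠ 0) : theta2 q = q ^ (1 / 4 : ℂ) * theta2Core q := by
  rw [theta2, theta2Core, ← tsum_mul_left]
  refine tsum_congr fun m => ?_
  have hexp : ((m ^ 2 + m).toNat : ℂ) = m ^ 2 + m := mod_cast
    congrArg (Int.cast : ℤ → ℂ) (natCast_toNat_sq_add_self m)
  rw [← Complex.cpow_natCast q (m ^ 2 + m).toNat, ← Complex.cpow_add _ _ hq, hexp]
  congr 1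
  ring

lemma theta2_zero : theta2 0 = 0 := by
  refine (tsum_congr (g := fun _ => (0 : ℂ)) fun m => ?_).trans tsum_zero
  refine Complex.zero_cpow (pow_ne_zero _ fun h => ?_)
  have h2 : ((2 * m + 1 : ℤ) : ℂ) = 0 := by
    push_cast
    linear_combination 2 * h
  have := Int.cast_eq_zero.mp h2
  omega

theorem theta2_pow_four (hq : ‖q‖ < 1) : theta2 q ^ 4 = theta3 q ^ 4 - theta4 q ^ 4 := by
  rw [theta3_pow_four_sub_theta4_pow_four hq]
  rcases eq_or_ne q 0 with rfl | hq0
  · rw [theta2_zero, zero_pow four_ne_zero, zero_mul]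
  · rw [theta2_eq hq0, mul_pow, ← Complex.cpow_nat_mul]
    norm_num

lemma theta3_sq_add_theta4_sq (hq : ‖q‖ < 1) :
    theta3 q ^ 2 + theta4 q ^ 2 = 2 * theta3 (q ^ 2) ^ 2 := by
  linear_combination theta3_sq hq + theta4_sq hq

lemma theta3_mul_theta4 (hq : ‖q‖ < 1) : theta3 q * theta4 q = theta4 (q ^ 2) ^ 2 := by
  have han : ∀ z : ℂ, ‖z‖ < 1 → AnalyticAt ℂ (fun z => theta4 (z ^ 2) ^ 2) z := fun z hz =>
    (analyticAt_comp_sq (analyticAt_theta4 (norm_sq_lt_one hz))).pow 2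
  refine eq_of_sq_eq_sq_unitDisc (fun z hz => (analyticAt_theta3 hz).mul (analyticAt_theta4 hz)) han
    (fun z hz => ?_) (by simp [theta3_zero, theta4_zero]) (by simp [theta3_zero, theta4_zero]) hq
  simp only [Pi.mul_apply]
  rw [mul_pow, theta3_sq hz, theta4_sq hz]
  linear_combination theta3_pow_four_sub_theta4_pow_four (norm_sq_lt_one hz)

end Theta

section EulerProduct

variable {q : ℂ}

/-- The Euler product `∏_{n ≥ 1} (1 - qⁿ)`. -/
def eulerProd (q : ℂ) : ℂ := ∏' n : ℕ, (1 - q ^ (n + 1))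

lemma norm_pow_succ_lt_one (hq : ‖q‖ < 1) (n : ℕ) : ‖q ^ (n + 1)‖ < 1 := by
  rw [norm_pow]
  exact pow_lt_one₀ (norm_nonneg _) hq n.succ_ne_zero

lemma one_sub_ne_zero_of_norm_lt_one (hq : ‖q‖ < 1) : 1 - q ≠ 0 := fun h => by
  simp [← sub_eq_zero.mp h] at hq

lemma one_add_ne_zero_of_norm_lt_one (hq : ‖q‖ < 1) : 1 + q ≠ 0 := by
  rw [← sub_neg_eq_add]
  exact one_sub_ne_zero_of_norm_lt_one (by rwa [norm_neg])

lemma one_sub_pow_succ_ne_zero (hq : ‖q‖ < 1) (n : ℕ) : 1 - q ^ (n + 1) ≠ 0 :=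
  one_sub_ne_zero_of_norm_lt_one (norm_pow_succ_lt_one hq n)

lemma one_add_pow_succ_ne_zero (hq : ‖q‖ < 1) (n : ℕ) : 1 + q ^ (n + 1) ≠ 0 :=
  one_add_ne_zero_of_norm_lt_one (norm_pow_succ_lt_one hq n)

lemma tendsto_eulerProd (hq : ‖q‖ < 1) :
    Tendsto (fun n => ∏ i ∈ range n, (1 - q ^ (i + 1))) atTop (𝓝 (eulerProd q)) :=
  (ModularForm.multipliable_one_sub_pow hq).hasProd.tendsto_prod_nat

lemma eulerProd_ne_zero (hq : ‖q‖ < 1) : eulerProd q ≠ 0 := by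
  have hs : Summable fun n : ℕ => ‖-q ^ (n + 1)‖ := by
    simpa using (summable_nat_add_iff 1).mpr (summable_geometric_of_lt_one (norm_nonneg _) hq)
  simpa only [eulerProd, sub_eq_add_neg] using tprod_one_add_ne_zero_of_summable
    (fun n => by simpa only [sub_eq_add_neg] using one_sub_pow_succ_ne_zero hq n) hs

lemma differentiableAt_eulerProd (hq : ‖q‖ < 1) : DifferentiableAt ℂ eulerProd q :=
  ModularForm.differentiableOn_tprod_one_sub_pow.differentiableAt
    (Metric.isOpen_ball.mem_nhds (mem_ball_zero_iff.mpr hq))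

lemma logDeriv_one_sub_pow_succ (q : ℂ) (n : ℕ) :
    logDeriv (fun z : ℂ => 1 - z ^ (n + 1)) q = -((n + 1) * q ^ n) / (1 - q ^ (n + 1)) := by
  simp [logDeriv_apply]

lemma summable_logDeriv_one_sub_pow_succ (hq : ‖q‖ < 1) :
    Summable fun n : ℕ => logDeriv (fun z : ℂ => 1 - z ^ (n + 1)) q := by
  have hnum : Summable fun n : ℕ => ‖-(((n : ℂ) + 1) * q ^ n)‖ := by
    simp_rw [norm_neg, add_one_mul]
    refine Summable.of_nonneg_of_le (fun _ => norm_nonneg _) (fun n => norm_add_le _ _) ?_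
    simpa using (summable_norm_pow_mul_geometric_of_norm_lt_one 1 hq).add
      (summable_norm_pow_mul_geometric_of_norm_lt_one 0 hq)
  simp_rw [logDeriv_one_sub_pow_succ, div_eq_mul_inv]
  refine hnum.mul_tendsto_const (c := (1 - 0)⁻¹) ?_
  rw [Nat.cofinite_eq_atTop]
  exact (((tendsto_pow_atTop_nhds_zero_of_norm_lt_one hq).comp
    (tendsto_add_atTop_nat 1)).const_sub 1).inv₀ (by simp)

lemma D_eulerProd (hq : ‖q‖ < 1) : D eulerProd q = -divisorSeries 1 q * eulerProd q := by
  have hlog : q * logDeriv eulerProd q = -divisorSeries 1 q := by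
    have htprod := logDeriv_tprod_eq_tsum (f := fun (n : ℕ) (z : ℂ) => 1 - z ^ (n + 1))
      Metric.isOpen_ball (mem_ball_zero_iff.mpr hq) (one_sub_pow_succ_ne_zero hq)
      (fun i => by fun_prop) (summable_logDeriv_one_sub_pow_succ hq)
      ModularForm.multipliableLocallyUniformlyOn_one_sub_pow (eulerProd_ne_zero hq)
    have hlambert : ∑' n : ℕ, ((n + 1 : ℕ) : ℂ) ^ 1 * q ^ (n + 1) / (1 - q ^ (n + 1)) =
        divisorSeries 1 q := by
      rw [← tsum_sigma_succ 1 hq, ← tsum_pnat_eq_tsum_succ (f := fun n => (σ 1 n : ℂ) * q ^ n),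
        ← tsum_pow_div_one_sub_eq_tsum_sigma hq,
        tsum_pnat_eq_tsum_succ (f := fun n => (n : ℂ) ^ 1 * q ^ n / (1 - q ^ n))]
    refine (congrArg (q * ·) htprod).trans ?_
    rw [← hlambert, ← tsum_mul_left, ← tsum_neg]
    refine tsum_congr fun n => ?_
    rw [logDeriv_one_sub_pow_succ]
    push_cast
    ring
  rw [← hlog, logDeriv_apply, D]
  field_simp [eulerProd_ne_zero hq]

end EulerProduct

section GaussProduct

variable {q : ℂ}

/-- The coefficient `(-1)ˢ (-1; q)_s / (q; q)_s` of `xˢ` in the expansion of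
`(x; q)_∞ / (-x; q)_∞`. -/
def gaussCoeff (q : ℂ) (s : ℕ) : ℂ := ∏ i ∈ range s, -(1 + q ^ i) / (1 - q ^ (i + 1))

/-- The truncated Gauss product `(q; q)_n / (-q; q)_n`. -/
def gaussProd (q : ℂ) (n : ℕ) : ℂ := ∏ i ∈ range n, (1 - q ^ (i + 1)) / (1 + q ^ (i + 1))

lemma gaussCoeff_succ (hq : ‖q‖ < 1) (s : ℕ) :
    gaussCoeff q (s + 1) * (1 - q ^ (s + 1)) = -(gaussCoeff q s * (1 + q ^ s)) := by
  rw [gaussCoeff, prod_range_succ, mul_assoc, div_mul_cancel₀ _ (one_sub_pow_succ_ne_zero hq s),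
    mul_neg, gaussCoeff]

lemma gaussProd_succ (hq : ‖q‖ < 1) (n : ℕ) :
    gaussProd q (n + 1) * (1 + q ^ (n + 1)) = gaussProd q n * (1 - q ^ (n + 1)) := by
  rw [gaussProd, prod_range_succ, mul_assoc, div_mul_cancel₀ _ (one_add_pow_succ_ne_zero hq n),
    gaussProd]

lemma gaussProd_mul_gaussCoeff (hq : ‖q‖ < 1) (n : ℕ) :
    gaussProd q n * gaussCoeff q n * (1 + q ^ n) = 2 * (-1) ^ n := by
  induction n with
  | zero => norm_num [gaussProd, gaussCoeff]
  | succ n ih =>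
    linear_combination gaussCoeff q (n + 1) * gaussProd_succ hq n +
      gaussProd q n * gaussCoeff_succ hq n - ih

/- The truncation of `(1 + x) F(x) = (1 - x) F(qx)`, where `F(x) = (x; q)_∞ / (-x; q)_∞`. -/
lemma sum_gaussCoeff_mul_pow (hq : ‖q‖ < 1) (x : ℂ) (n : ℕ) :
    (1 + x) * ∑ s ∈ range (n + 1), gaussCoeff q s * x ^ s =
      (1 - x) * ∑ s ∈ range (n + 1), gaussCoeff q s * (x * q) ^ s +
        gaussCoeff q n * (1 + q ^ n) * x ^ (n + 1) := by
  induction n with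
  | zero =>
    simp [gaussCoeff]
    ring
  | succ n ih =>
    rw [sum_range_succ, sum_range_succ (fun s => gaussCoeff q s * (x * q) ^ s), mul_pow]
    linear_combination ih + x ^ (n + 1) * gaussCoeff_succ hq n

lemma one_add_two_mul_sum_neg_one_pow_mul_pow_sq (hq : ‖q‖ < 1) (n : ℕ) :
    1 + 2 * ∑ k ∈ range n, (-1) ^ (k + 1) * q ^ ((k + 1) ^ 2) =
      gaussProd q n * ∑ s ∈ range (n + 1), gaussCoeff q s * (q ^ (n + 1)) ^ s := by
  induction n with
  | zero => simp [gaussProd, gaussCoeff]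
  | succ n ih =>
    have hne := one_add_pow_succ_ne_zero hq n
    have hfunctional := sum_gaussCoeff_mul_pow hq (q ^ (n + 1)) n
    have hlast := gaussProd_mul_gaussCoeff hq n
    have hlast' := gaussProd_mul_gaussCoeff hq (n + 1)
    have hsq : q ^ ((n + 1) ^ 2) = (q ^ (n + 1)) ^ (n + 1) := by rw [← pow_mul, sq]
    have hlong : (q ^ (n + 1 + 1)) ^ (n + 1) = (q ^ (n + 1)) ^ (n + 1) * q ^ (n + 1) := by
      rw [pow_succ q (n + 1), mul_pow]
    rw [sum_range_succ, mul_add, ← add_assoc, ih, sum_range_succ _ (n + 1), hsq, hlong]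
    rw [← pow_succ] at hfunctional
    refine mul_right_cancel₀ hne ?_
    linear_combination gaussProd q n * hfunctional + (q ^ (n + 1)) ^ (n + 1) * hlast -
      (q ^ (n + 1)) ^ (n + 1) * q ^ (n + 1) * hlast' -
      (∑ s ∈ range (n + 1), gaussCoeff q s * (q ^ (n + 1 + 1)) ^ s) * gaussProd_succ hq n

lemma tendsto_gaussProd (hq : ‖q‖ < 1) :
    Tendsto (gaussProd q) atTop (𝓝 (eulerProd q ^ 2 / eulerProd (q ^ 2))) := by
  have hq2 := norm_sq_lt_one hq
  refine (((tendsto_eulerProd hq).pow 2).div (tendsto_eulerProd hq2)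
    (eulerProd_ne_zero hq2)).congr fun n => ?_
  rw [gaussProd, Pi.div_apply, ← prod_pow, ← prod_div_distrib]
  refine prod_congr rfl fun i _ => ?_
  have hsub := one_sub_pow_succ_ne_zero hq i
  rw [← pow_mul, mul_comm 2, pow_mul, show 1 - (q ^ (i + 1)) ^ 2 =
    (1 - q ^ (i + 1)) * (1 + q ^ (i + 1)) by ring, sq, mul_div_mul_left _ _ hsub]

/- The limit of `gaussProd` is nonzero, so `gaussProd_mul_gaussCoeff` bounds the coefficients. -/
lemma exists_norm_gaussCoeff_le (hq : ‖q‖ < 1) : ∃ C, ∀ s, ‖gaussCoeff q s‖ ≤ C := by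
  have hlim : eulerProd q ^ 2 / eulerProd (q ^ 2) * (1 + 0) ≠ 0 := by
    simpa using ⟨eulerProd_ne_zero hq, eulerProd_ne_zero (norm_sq_lt_one hq)⟩
  have htendsto := (((tendsto_gaussProd hq).mul
    ((tendsto_pow_atTop_nhds_zero_of_norm_lt_one hq).const_add 1)).inv₀ hlim).norm.const_mul 2
  obtain ⟨C, hC⟩ := htendsto.bddAbove_range
  refine ⟨C, fun s => le_trans (le_of_eq ?_) (hC ⟨s, rfl⟩)⟩
  have hnorm := congrArg norm (gaussProd_mul_gaussCoeff hq s)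
  simp only [norm_mul, norm_pow, norm_neg, norm_one, one_pow, mul_one, RCLike.norm_ofNat] at hnorm
  have hne : ‖gaussProd q s‖ * ‖1 + q ^ s‖ ≠ 0 := fun h => by
    rw [mul_right_comm, h, zero_mul] at hnorm
    norm_num at hnorm
  simp only [norm_inv, norm_mul]
  rw [← hnorm, mul_right_comm ‖gaussProd q s‖, mul_right_comm _ ‖gaussCoeff q s‖,
    mul_inv_cancel₀ hne, one_mul]

lemma tendsto_sum_gaussCoeff (hq : ‖q‖ < 1) :
    Tendsto (fun n => ∑ s ∈ range (n + 1), gaussCoeff q s * (q ^ (n + 1)) ^ s) atTop (𝓝 1) := by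
  obtain ⟨C, hC⟩ := exists_norm_gaussCoeff_le hq
  have hbound : Tendsto (fun n : ℕ => n * (C * ‖q‖ ^ (n + 1))) atTop (𝓝 0) := by
    have h := (tendsto_self_mul_const_pow_of_lt_one (norm_nonneg q) hq).const_mul (C * ‖q‖)
    rw [mul_zero] at h
    exact h.congr fun n => by ring
  rw [tendsto_iff_norm_sub_tendsto_zero]
  refine squeeze_zero (fun _ => norm_nonneg _) (fun n => ?_) hbound
  rw [sum_range_succ', pow_zero, mul_one, gaussCoeff, range_zero, prod_empty, add_sub_cancel_right]
  refine (norm_sum_le_of_le (range n) (f := fun s => _) fun s _ => ?_).trans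
    (by rw [sum_const, card_range, nsmul_eq_mul])
  rw [norm_mul, norm_pow, norm_pow]
  gcongr
  · exact (norm_nonneg _).trans (hC 0)
  · exact hC _
  · exact pow_le_of_le_one (by positivity) (pow_le_one₀ (norm_nonneg _) hq.le) s.succ_ne_zero

lemma summable_norm_theta4 (hq : ‖q‖ < 1) :
    Summable fun m : ℤ => ‖(-1 : ℂ) ^ m * q ^ (m ^ 2).toNat‖ := by
  simpa [norm_zpow] using summable_norm_theta3 hq

lemma tendsto_theta4 (hq : ‖q‖ < 1) :
    Tendsto (fun n => 1 + 2 * ∑ k ∈ range n, (-1) ^ (k + 1) * q ^ ((k + 1) ^ 2)) atTop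
      (𝓝 (theta4 q)) := by
  have hs := (summable_norm_theta4 hq).of_norm
  have htoNat : ∀ n : ℕ, ((n : ℤ) ^ 2).toNat = n ^ 2 := fun n => by
    rw [← Nat.cast_pow, Int.toNat_natCast]
  have htsum : theta4 q = 1 + 2 * ∑' k : ℕ, (-1) ^ (k + 1) * q ^ ((k + 1) ^ 2) := by
    rw [theta4, tsum_int_eq_zero_add_two_mul_tsum_pnat (fun m => by simp [← inv_zpow]) hs]
    simp only [zpow_natCast, htoNat]
    rw [tsum_pnat_eq_tsum_succ (f := fun n => (-1 : ℂ) ^ n * q ^ (n ^ 2))]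
    simp
  have hnat : Summable fun k : ℕ => (-1 : ℂ) ^ (k + 1) * q ^ ((k + 1) ^ 2) := by
    refine (summable_nat_add_iff (f := fun k : ℕ => (-1 : ℂ) ^ k * q ^ (k ^ 2)) 1).mpr ?_
    simpa only [Function.comp_def, zpow_natCast, htoNat] using
      hs.comp_injective Nat.cast_injective
  rw [htsum]
  exact (hnat.tendsto_sum_tsum_nat.const_mul 2).const_add 1

theorem theta4_mul_eulerProd (hq : ‖q‖ < 1) :
    theta4 q * eulerProd (q ^ 2) = eulerProd q ^ 2 := by
  have hlim := (tendsto_gaussProd hq).mul (tendsto_sum_gaussCoeff hq)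
  simp only [← one_add_two_mul_sum_neg_one_pow_mul_pow_sq hq, mul_one] at hlim
  rw [tendsto_nhds_unique (tendsto_theta4 hq) hlim,
    div_mul_cancel₀ _ (eulerProd_ne_zero (norm_sq_lt_one hq))]

lemma theta4_ne_zero (hq : ‖q‖ < 1) : theta4 q ≠ 0 := fun h =>
  pow_ne_zero 2 (eulerProd_ne_zero hq) (by rw [← theta4_mul_eulerProd hq, h, zero_mul])

lemma theta3_ne_zero (hq : ‖q‖ < 1) : theta3 q ≠ 0 := by
  rw [← neg_neg q, ← theta4_eq_theta3_neg]
  exact theta4_ne_zero (by rwa [norm_neg])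

theorem D_theta4_eq (hq : ‖q‖ < 1) :
    D theta4 q = theta4 q * (Eis 1 q - Eis 1 (q ^ 2)) / 12 := by
  have hq2 := norm_sq_lt_one hq
  have hdiff := differentiableAt_eulerProd hq2
  have hcomp : DifferentiableAt ℂ (fun z => eulerProd (z ^ 2)) q :=
    DifferentiableAt.comp (f := fun z => z ^ 2) q hdiff (by fun_prop)
  have hD := D_congr (fun z hz => theta4_mul_eulerProd hz) hq
  rw [D_mul (analyticAt_theta4 hq).differentiableAt hcomp, D_comp_sq hdiff,
    D_pow (differentiableAt_eulerProd hq), D_eulerProd hq, D_eulerProd hq2] at hD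
  refine mul_right_cancel₀ (eulerProd_ne_zero hq2) ?_
  rw [Eis_one_eq hq, Eis_one_eq hq2]
  push_cast at hD
  linear_combination hD + 2 * divisorSeries 1 q * theta4_mul_eulerProd hq

end GaussProduct

section ThetaDerivatives

variable {q : ℂ}

lemma theta3_mul_D_theta3_add (hq : ‖q‖ < 1) :
    theta3 q * D theta3 q + theta4 q * D theta4 q = 4 * (theta3 (q ^ 2) * D theta3 (q ^ 2)) := by
  have hq2 := norm_sq_lt_one hq
  have h3 := (analyticAt_theta3 hq).differentiableAt
  have h4 := (analyticAt_theta4 hq).differentiableAt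
  have hD := D_congr (fun z hz => theta3_sq_add_theta4_sq hz) hq
  rw [D_add (h3.fun_pow 2) (h4.fun_pow 2), D_pow h3, D_pow h4, D_const_mul,
    D_comp_sq (f := fun z => theta3 z ^ 2) ((analyticAt_theta3 hq2).pow 2).differentiableAt,
    D_pow (analyticAt_theta3 hq2).differentiableAt] at hD
  push_cast at hD
  linear_combination hD / 2

lemma D_theta3_mul_theta4_add (hq : ‖q‖ < 1) :
    D theta3 q * theta4 q + theta3 q * D theta4 q = 4 * (theta4 (q ^ 2) * D theta4 (q ^ 2)) := by
  have hq2 := norm_sq_lt_one hq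
  have h4 := (analyticAt_theta4 hq2).differentiableAt
  have hD := D_congr (fun z hz => theta3_mul_theta4 hz) hq
  rw [D_mul (analyticAt_theta3 hq).differentiableAt (analyticAt_theta4 hq).differentiableAt,
    D_comp_sq (f := fun z => theta4 z ^ 2) (h4.fun_pow 2), D_pow h4] at hD
  push_cast at hD
  linear_combination hD

lemma deriv_theta3_sub_deriv_theta4_zero : deriv theta3 0 - deriv theta4 0 = 4 := by
  have h3 := (analyticAt_theta3 (q := 0) (by simp)).differentiableAt.hasDerivAt
  have h4 := (analyticAt_theta4 (q := 0) (by simp)).differentiableAt.hasDerivAt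
  have hcore : AnalyticAt ℂ (fun z => theta2Core (z ^ 2) ^ 2) 0 :=
    (analyticAt_comp_sq (analyticAt_theta2Core (by simp))).pow 2
  have hleft := (h3.pow 2).sub (h4.pow 2)
  have hright := ((hasDerivAt_id (0 : ℂ)).mul hcore.differentiableAt.hasDerivAt).const_mul 2
  have heq : (theta3 ^ 2 - theta4 ^ 2) =ᶠ[𝓝 0] fun z => 2 * (z * theta2Core (z ^ 2) ^ 2) :=
    (eventually_norm_lt_one (by simp)).mono fun z hz => by
      simp only [Pi.sub_apply, Pi.pow_apply]
      linear_combination theta3_sq hz - theta4_sq hz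
  have h := hleft.unique (hright.congr_of_eventuallyEq heq)
  norm_num [theta3_zero, theta4_zero, theta2Core_zero] at h
  linear_combination h / 2

/-- The defect in the Wronskian relation between `θ_3` and `θ_4`, divided by `q`. -/
def wronskianDefect (q : ℂ) : ℂ :=
  4 * (theta3 q * deriv theta4 q - theta4 q * deriv theta3 q) +
    theta2Core q ^ 4 * (theta3 q * theta4 q)

lemma analyticAt_wronskianDefect (hq : ‖q‖ < 1) : AnalyticAt ℂ wronskianDefect q := by
  have h3 := analyticAt_theta3 hq
  have h4 := analyticAt_theta4 hq
  exact (analyticAt_const.mul ((h3.mul h4.deriv).sub (h4.mul h3.deriv))).add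
    (((analyticAt_theta2Core hq).pow 4).mul (h3.mul h4))

lemma wronskianDefect_zero : wronskianDefect 0 = 0 := by
  rw [wronskianDefect, theta3_zero, theta4_zero, theta2Core_zero]
  linear_combination -4 * deriv_theta3_sub_deriv_theta4_zero

lemma mul_wronskianDefect (hq : ‖q‖ < 1) :
    q * wronskianDefect q = 4 * (theta3 q * D theta4 q - theta4 q * D theta3 q) +
      (theta3 q ^ 4 - theta4 q ^ 4) * (theta3 q * theta4 q) := by
  rw [wronskianDefect, theta3_pow_four_sub_theta4_pow_four hq, D, D]
  ring

lemma theta3_comp_sq_pow_four (hq : ‖q‖ < 1) :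
    theta3 (q ^ 2) ^ 4 = ((theta3 q ^ 2 + theta4 q ^ 2) / 2) ^ 2 := by
  rw [theta3_sq_add_theta4_sq hq]
  ring

lemma theta4_comp_sq_pow_four (hq : ‖q‖ < 1) :
    theta4 (q ^ 2) ^ 4 = (theta3 q * theta4 q) ^ 2 := by
  rw [theta3_mul_theta4 hq]
  ring

lemma theta2Core_sq_mul_wronskianDefect (hq : ‖q‖ < 1) :
    theta2Core (q ^ 2) ^ 2 * wronskianDefect q =
      4 * (theta3 (q ^ 2) * theta4 (q ^ 2)) * wronskianDefect (q ^ 2) := by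
  rcases eq_or_ne q 0 with rfl | hq0
  · simp [wronskianDefect_zero]
  have hq2 := norm_sq_lt_one hq
  have hsum := theta3_sq_add_theta4_sq hq
  have hmul := theta3_mul_theta4 hq
  have hderiv : (theta3 q ^ 2 - theta4 q ^ 2) * (theta3 q * D theta4 q - theta4 q * D theta3 q) =
      8 * (theta3 (q ^ 2) * theta4 (q ^ 2)) *
        (theta3 (q ^ 2) * D theta4 (q ^ 2) - theta4 (q ^ 2) * D theta3 (q ^ 2)) := by
    linear_combination 2 * theta3 (q ^ 2) ^ 2 * D_theta3_mul_theta4_add hq -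
      2 * theta4 (q ^ 2) ^ 2 * theta3_mul_D_theta3_add hq +
      (D theta3 q * theta4 q + theta3 q * D theta4 q) * hsum -
      2 * (theta3 q * D theta3 q + theta4 q * D theta4 q) * hmul
  have hquartic : (theta3 q ^ 2 - theta4 q ^ 2) * (theta3 q ^ 4 - theta4 q ^ 4) *
      (theta3 q * theta4 q) = 4 * (2 * theta3 (q ^ 2) ^ 2) * theta4 (q ^ 2) ^ 2 *
        (theta3 (q ^ 2) ^ 4 - theta4 (q ^ 2) ^ 4) := by
    rw [theta3_comp_sq_pow_four hq, theta4_comp_sq_pow_four hq, ← hsum, ← hmul]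
    ring
  refine mul_left_cancel₀ (pow_ne_zero 2 hq0) ?_
  linear_combination
    q * theta2Core (q ^ 2) ^ 2 * mul_wronskianDefect hq -
      4 * (theta3 (q ^ 2) * theta4 (q ^ 2)) * mul_wronskianDefect hq2 -
      (4 * (theta3 q * D theta4 q - theta4 q * D theta3 q) +
        (theta3 q ^ 4 - theta4 q ^ 4) * (theta3 q * theta4 q)) / 2 *
        (theta3_sq hq - theta4_sq hq) + 2 * hderiv + hquartic / 2

theorem wronskianDefect_eq_zero (hq : ‖q‖ < 1) : wronskianDefect q = 0 := by
  have hq2 := norm_sq_lt_one (q := 0) (by simp)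
  have hcore : AnalyticAt ℂ (fun z => theta2Core (z ^ 2) ^ 2) 0 :=
    (analyticAt_comp_sq (analyticAt_theta2Core hq2)).pow 2
  have hcore_zero : theta2Core (0 ^ 2) ^ 2 ≠ 0 := by
    rw [zero_pow two_ne_zero, theta2Core_zero]
    norm_num
  refine eq_zero_of_eq_mul_comp_sq
    (c := fun z => 4 * (theta3 (z ^ 2) * theta4 (z ^ 2)) / theta2Core (z ^ 2) ^ 2)
    (fun z hz => analyticAt_wronskianDefect hz)
    ((analyticAt_const.mul ((analyticAt_comp_sq (analyticAt_theta3 hq2)).mul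
      (analyticAt_comp_sq (analyticAt_theta4 hq2)))).div hcore hcore_zero)
    wronskianDefect_zero ?_ hq
  filter_upwards [eventually_norm_lt_one (q := 0) (by simp),
    hcore.continuousAt.eventually_ne hcore_zero] with z hz hne
  rw [div_mul_eq_mul_div, eq_div_iff hne, mul_comm, theta2Core_sq_mul_wronskianDefect hz]

lemma D_theta3_eq (hq : ‖q‖ < 1) :
    D theta3 q =
      theta3 q * ((Eis 1 q - Eis 1 (q ^ 2)) / 12 + (theta3 q ^ 4 - theta4 q ^ 4) / 4) := by
  have hwronskian := mul_wronskianDefect hq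
  rw [wronskianDefect_eq_zero hq, mul_zero] at hwronskian
  refine mul_left_cancel₀ (theta4_ne_zero hq) ?_
  linear_combination theta3 q * D_theta4_eq hq + hwronskian / 4

end ThetaDerivatives

section EisensteinTheta

variable {q : ℂ}

lemma Eis_one_comp_sq_sub (hq : ‖q‖ < 1) :
    4 * (Eis 1 (q ^ 2) - Eis 1 ((q ^ 2) ^ 2)) =
      2 * (Eis 1 q - Eis 1 (q ^ 2)) + 3 * (theta3 q ^ 4 - theta4 q ^ 4) := by
  have hD := D_theta3_mul_theta4_add hq
  rw [D_theta3_eq hq, D_theta4_eq hq, D_theta4_eq (norm_sq_lt_one hq)] at hD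
  refine mul_left_cancel₀ (mul_ne_zero (theta3_ne_zero hq) (theta4_ne_zero hq)) ?_
  linear_combination -12 * hD +
    4 * (Eis 1 (q ^ 2) - Eis 1 ((q ^ 2) ^ 2)) * theta3_mul_theta4 hq

lemma Eis_one_zero : Eis 1 0 = 1 := by
  rw [Eis_one_eq (by simp), divisorSeries_zero, mul_zero, sub_zero]

lemma Eis_two_zero : Eis 2 0 = 1 := by
  rw [Eis_two_eq (by simp), divisorSeries_zero, mul_zero, add_zero]

lemma analyticAt_G2 (hq : ‖q‖ < 1) : AnalyticAt ℂ G2 q :=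
  (analyticAt_const.mul (analyticAt_comp_sq (analyticAt_Eis_one (norm_sq_lt_one hq)))).sub
    (analyticAt_Eis_one hq)

theorem G2_eq_theta (hq : ‖q‖ < 1) : G2 q = 2 * theta3 q ^ 4 - theta4 q ^ 4 := by
  let f : ℂ → ℂ := fun z => G2 z - (2 * theta3 z ^ 4 - theta4 z ^ 4)
  have hf : ∀ z, ‖z‖ < 1 → AnalyticAt ℂ f z := fun z hz =>
    (analyticAt_G2 hz).sub ((analyticAt_const.mul ((analyticAt_theta3 hz).pow 4)).sub
      ((analyticAt_theta4 hz).pow 4))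
  refine sub_eq_zero.mp (eq_zero_of_eq_mul_comp_sq hf (c := fun _ => 1) analyticAt_const ?_
    ((eventually_norm_lt_one (by simp)).mono fun z hz => ?_) hq)
  · simp only [f, G2]
    rw [zero_pow two_ne_zero, theta3_zero, theta4_zero, Eis_one_zero]
    norm_num
  · simp only [f, G2]
    rw [theta3_comp_sq_pow_four hz, theta4_comp_sq_pow_four hz]
    linear_combination Eis_one_comp_sq_sub hz / 2

theorem G2_eq_Theta (hq : ‖q‖ < 1) : G2 q = Theta 0 1 q := by
  rw [G2_eq_theta hq, Theta, mul_zero, pow_zero, pow_zero, mul_one, theta2_pow_four hq]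
  ring

theorem D_theta4 (hq : ‖q‖ < 1) : D theta4 q = theta4 q * ((Eis 1 q - G2 q) / 24) := by
  rw [D_theta4_eq hq, G2]
  ring

lemma Eis_one_comp_sq (hq : ‖q‖ < 1) :
    Eis 1 (q ^ 2) = (Eis 1 q + (2 * theta3 q ^ 4 - theta4 q ^ 4)) / 2 := by
  rw [← G2_eq_theta hq, G2]
  ring

lemma D_theta3 (hq : ‖q‖ < 1) :
    D theta3 q = theta3 q * ((Eis 1 q + 4 * theta3 q ^ 4 - 5 * theta4 q ^ 4) / 24) := by
  rw [D_theta3_eq hq, Eis_one_comp_sq hq]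
  ring

lemma D_G2_eq_theta (hq : ‖q‖ < 1) :
    D G2 q = 8 * theta3 q ^ 3 * D theta3 q - 4 * theta4 q ^ 3 * D theta4 q := by
  have h3 := (analyticAt_theta3 hq).differentiableAt
  have h4 := (analyticAt_theta4 hq).differentiableAt
  rw [D_congr (fun z hz => G2_eq_theta hz) hq, D_sub ((h3.fun_pow 4).const_mul 2) (h4.fun_pow 4),
    D_const_mul, D_pow h3, D_pow h4]
  push_cast
  ring

lemma D_G2_eq_Eis (hq : ‖q‖ < 1) : D G2 q = 4 * D (Eis 1) (q ^ 2) - D (Eis 1) q := by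
  have hq2 := norm_sq_lt_one hq
  have hcomp := (analyticAt_comp_sq (analyticAt_Eis_one hq2)).differentiableAt
  rw [show G2 = fun z => 2 * Eis 1 (z ^ 2) - Eis 1 z from rfl,
    D_sub (hcomp.const_mul 2) (analyticAt_Eis_one hq).differentiableAt, D_const_mul,
    D_comp_sq (analyticAt_Eis_one hq2).differentiableAt]
  ring

theorem Eis_two_eq_theta (hq : ‖q‖ < 1) :
    Eis 2 q = 16 * theta3 q ^ 8 - 16 * theta3 q ^ 4 * theta4 q ^ 4 + theta4 q ^ 8 := by
  let f : ℂ → ℂ := fun z =>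
    Eis 2 z - (16 * theta3 z ^ 8 - 16 * (theta3 z ^ 4 * theta4 z ^ 4) + theta4 z ^ 8)
  have hf : ∀ z, ‖z‖ < 1 → AnalyticAt ℂ f z := fun z hz => by
    have h3 := analyticAt_theta3 hz
    have h4 := analyticAt_theta4 hz
    exact (analyticAt_Eis_two hz).sub (((analyticAt_const.mul (h3.pow 8)).sub
      (analyticAt_const.mul ((h3.pow 4).mul (h4.pow 4)))).add (h4.pow 8))
  rw [mul_assoc]
  refine sub_eq_zero.mp (eq_zero_of_eq_mul_comp_sq hf (c := fun _ => 4) analyticAt_const ?_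
    ((eventually_norm_lt_one (by simp)).mono fun z hz => ?_) hq)
  · simp only [f]
    rw [theta3_zero, theta4_zero, Eis_two_zero]
    norm_num
  · have hD := D_G2_eq_theta hz
    rw [D_G2_eq_Eis hz, D_Eis_one hz, D_Eis_one (norm_sq_lt_one hz), D_theta3 hz, D_theta4 hz,
      Eis_one_comp_sq hz, G2_eq_theta hz] at hD
    simp only [f]
    rw [pow_mul (theta3 (z ^ 2)) 4 2, pow_mul (theta4 (z ^ 2)) 4 2, theta3_comp_sq_pow_four hz,
      theta4_comp_sq_pow_four hz]
    linear_combination 12 * hD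

theorem D_G2 (hq : ‖q‖ < 1) :
    D G2 q = Eis 1 q * G2 q / 6 - G2 q ^ 2 / 3 + Eis 2 q / 6 := by
  rw [D_G2_eq_theta hq, D_theta3 hq, D_theta4 hq, Eis_two_eq_theta hq, G2_eq_theta hq]
  ring

theorem D_Eis_two (hq : ‖q‖ < 1) :
    D (Eis 2) q = Eis 1 q * Eis 2 q / 3 + G2 q * Eis 2 q - 4 / 3 * G2 q ^ 3 := by
  have h3 := (analyticAt_theta3 hq).differentiableAt
  have h4 := (analyticAt_theta4 hq).differentiableAt
  have hprod := ((h3.fun_pow 4).const_mul 16).fun_mul (h4.fun_pow 4)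
  have hD := D_congr (fun z hz => Eis_two_eq_theta hz) hq
  rw [D_add (((h3.fun_pow 8).const_mul 16).fun_sub hprod) (h4.fun_pow 8),
    D_sub ((h3.fun_pow 8).const_mul 16) hprod, D_mul ((h3.fun_pow 4).const_mul 16) (h4.fun_pow 4),
    D_const_mul, D_const_mul, D_pow h3, D_pow h3, D_pow h4, D_pow h4, D_theta3 hq,
    D_theta4 hq, G2_eq_theta hq] at hD
  rw [hD, Eis_two_eq_theta hq, G2_eq_theta hq]
  push_cast
  ring

end EisensteinTheta

section Recursion

variable {t : ℕ}

/-- The index set of the theorem: exponents `(α, β, γ)` of monomials of weight `α + β + 2γ = t`. -/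
def exponents (t : ℕ) : Finset (ℕ × ℕ × ℕ) :=
  (range (t + 1) ×ˢ range (t + 1) ×ˢ range (t + 1)).filter
    (fun x : ℕ × ℕ × ℕ => x.1 + x.2.1 + 2 * x.2.2 = t)

lemma mem_exponents {x : ℕ × ℕ × ℕ} : x ∈ exponents t ↔ x.1 + x.2.1 + 2 * x.2.2 = t := by
  simp only [exponents, mem_filter, mem_product, mem_range]
  omega

lemma cTilde_eq_zero {α β γ : ℤ} (h : α < 0 ∨ β < 0 ∨ γ < 0) : cTilde α β γ = 0 := by
  rw [cTilde, if_pos h]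

lemma cTilde_zero : cTilde 0 0 0 = 1 := by
  rw [cTilde, if_neg (by simp), if_pos (by simp)]

lemma cTilde_rec {α β γ : ℕ} (h : 0 < α + β + 2 * γ) :
    cTilde α β γ = (2 * (α : ℚ) + 4 * β + 8 * γ - 1) / 24 * cTilde (α - 1) β γ
      + (24 * (γ : ℚ) - 8 * β + 7) / 24 * cTilde α (β - 1) γ
      - ((α : ℚ) + 1) / 12 * cTilde (α + 1) β (γ - 1)
      + ((β : ℚ) + 1) / 6 * cTilde α (β + 1) (γ - 1)
      - 4 * ((γ : ℚ) + 1) / 3 * cTilde α (β - 3) (γ + 1) := by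
  rw [cTilde, if_neg (by omega), if_neg (by omega)]
  simp only [Int.cast_natCast]

lemma sum_exponents_eq_finsum {M : Type*} [AddCommMonoid M] {w : ℤ → ℤ → ℤ → M}
    (hw : ∀ α β γ, α < 0 ∨ β < 0 ∨ γ < 0 → w α β γ = 0) :
    ∑ x ∈ exponents t, w x.1 x.2.1 x.2.2 =
      ∑ᶠ p ∈ {p : ℤ × ℤ × ℤ | p.1 + p.2.1 + 2 * p.2.2 = t}, w p.1 p.2.1 p.2.2 := by
  let cast : ℕ × ℕ × ℕ ↪ ℤ × ℤ × ℤ :=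
    Nat.castEmbedding.prodMap (Nat.castEmbedding.prodMap Nat.castEmbedding)
  rw [finsum_mem_eq_sum_of_inter_support_eq (t := (exponents t).map cast), sum_map]
  · rfl
  ext ⟨α, β, γ⟩
  refine and_congr_left fun hne => ?_
  have hnonneg : 0 ≤ α ∧ 0 ≤ β ∧ 0 ≤ γ := by
    by_contra hneg
    exact hne (hw α β γ (by omega))
  lift α to ℕ using hnonneg.1
  lift β to ℕ using hnonneg.2.1
  lift γ to ℕ using hnonneg.2.2
  rw [mem_coe, show ((α : ℤ), (β : ℤ), (γ : ℤ)) = cast (α, β, γ) from rfl, Finset.mem_map',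
    mem_exponents]
  exact (by norm_cast : (α + β + 2 * γ : ℤ) = t ↔ α + β + 2 * γ = t)

lemma sum_exponents_cTilde_shift {g : ℤ → ℤ → ℤ → ℂ} {d e f : ℤ} (hweight : d + e + 2 * f = 1)
    (hg : ∀ α β γ, d ≤ α → e ≤ β → f ≤ γ → α < 0 ∨ β < 0 ∨ γ < 0 → g α β γ = 0) :
    ∑ x ∈ exponents (t + 1),
        g x.1 x.2.1 x.2.2 * (cTilde (x.1 - d) (x.2.1 - e) (x.2.2 - f) : ℂ) =
      ∑ x ∈ exponents t,
        g (x.1 + d) (x.2.1 + e) (x.2.2 + f) * (cTilde x.1 x.2.1 x.2.2 : ℂ) := by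
  rw [sum_exponents_eq_finsum
      (w := fun α β γ => g α β γ * (cTilde (α - d) (β - e) (γ - f) : ℂ)),
    sum_exponents_eq_finsum
      (w := fun α β γ => g (α + d) (β + e) (γ + f) * (cTilde α β γ : ℂ))]
  · refine (finsum_mem_eq_of_bijOn (fun p => (p.1 + d, p.2.1 + e, p.2.2 + f)) ⟨?_, ?_, ?_⟩ ?_).symm
    · rintro ⟨α, β, γ⟩ h
      simp only [Set.mem_ofPred_eq] at h ⊢
      push_cast
      linarith
    · rintro ⟨α, β, γ⟩ - ⟨α', β', γ'⟩ - h
      simpa using h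
    · rintro ⟨α, β, γ⟩ h
      refine ⟨(α - d, β - e, γ - f), ?_, by simp⟩
      simp only [Set.mem_ofPred_eq] at h ⊢
      push_cast at h
      linarith
    · intro p _
      simp only [add_sub_cancel_right]
  · intro α β γ h
    rw [cTilde_eq_zero h, Rat.cast_zero, mul_zero]
  · intro α β γ h
    by_cases hneg : α - d < 0 ∨ β - e < 0 ∨ γ - f < 0
    · rw [cTilde_eq_zero hneg, Rat.cast_zero, mul_zero]
    · rw [hg α β γ (by omega) (by omega) (by omega) h, zero_mul]

/-- The polynomial `∑ c̃(α, β, γ) X^α Y^β Z^γ` over `α + β + 2γ = t`, which will be evaluated at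
`X = E_2`, `Y = G_2`, `Z = E_4`. -/
def weightPoly (t : ℕ) (X Y Z : ℂ) : ℂ :=
  ∑ x ∈ exponents t, (cTilde x.1 x.2.1 x.2.2 : ℂ) * (X ^ x.1 * Y ^ x.2.1 * Z ^ x.2.2)

lemma weightPoly_zero (X Y Z : ℂ) : weightPoly 0 X Y Z = 1 := by
  have hzero : exponents 0 = {(0, 0, 0)} := rfl
  simp [weightPoly, hzero, cTilde_zero]

lemma weightPoly_succ (t : ℕ) (X Y Z : ℂ) :
    weightPoly (t + 1) X Y Z = ∑ x ∈ exponents t, (cTilde x.1 x.2.1 x.2.2 : ℂ) *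
      ((2 * x.1 + 4 * x.2.1 + 8 * x.2.2 + 1) / 24 * (X ^ (x.1 + 1) * Y ^ x.2.1 * Z ^ x.2.2)
      + (24 * x.2.2 - 8 * x.2.1 - 1) / 24 * (X ^ x.1 * Y ^ (x.2.1 + 1) * Z ^ x.2.2)
      - x.1 / 12 * (X ^ (x.1 - 1) * Y ^ x.2.1 * Z ^ (x.2.2 + 1))
      + x.2.1 / 6 * (X ^ x.1 * Y ^ (x.2.1 - 1) * Z ^ (x.2.2 + 1))
      - 4 * x.2.2 / 3 * (X ^ x.1 * Y ^ (x.2.1 + 3) * Z ^ (x.2.2 - 1))) := by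
  let M : ℤ → ℤ → ℤ → ℂ := fun α β γ => X ^ α.toNat * Y ^ β.toNat * Z ^ γ.toNat
  have hX := sum_exponents_cTilde_shift (t := t) (d := 1) (e := 0) (f := 0) (by norm_num)
    (g := fun α β γ => (2 * (α : ℂ) + 4 * β + 8 * γ - 1) / 24 * M α β γ)
    (fun α β γ _ _ _ _ => by omega)
  have hY := sum_exponents_cTilde_shift (t := t) (d := 0) (e := 1) (f := 0) (by norm_num)
    (g := fun α β γ => (24 * (γ : ℂ) - 8 * β + 7) / 24 * M α β γ)
    (fun α β γ _ _ _ _ => by omega)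
  have hXZ := sum_exponents_cTilde_shift (t := t) (d := -1) (e := 0) (f := 1) (by norm_num)
    (g := fun α β γ => ((α : ℂ) + 1) / 12 * M α β γ)
    (fun α β γ _ _ _ _ => by simp [show α = -1 by omega])
  have hYZ := sum_exponents_cTilde_shift (t := t) (d := 0) (e := -1) (f := 1) (by norm_num)
    (g := fun α β γ => ((β : ℂ) + 1) / 6 * M α β γ)
    (fun α β γ _ _ _ _ => by simp [show β = -1 by omega])
  have hZY := sum_exponents_cTilde_shift (t := t) (d := 0) (e := 3) (f := -1) (by norm_num)
    (g := fun α β γ => 4 * ((γ : ℂ) + 1) / 3 * M α β γ)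
    (fun α β γ _ _ _ _ => by simp [show γ = -1 by omega])
  have hshift := congr($hX + $hY - $hXZ + $hYZ - $hZY)
  simp only [← sum_add_distrib, ← sum_sub_distrib] at hshift
  refine (sum_congr rfl fun x hx => ?_).trans (hshift.trans (sum_congr rfl fun x _ => ?_))
  · rw [cTilde_rec (by rw [mem_exponents] at hx; omega)]
    simp only [M, Int.toNat_natCast, sub_zero, sub_neg_eq_add]
    push_cast
    ring
  · have hpred (n : ℕ) : ((n : ℤ) + -1).toNat = n - 1 := by omega
    have hsucc_one (n : ℕ) : ((n : ℤ) + 1).toNat = n + 1 := by omega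
    have hadd_three (n : ℕ) : ((n : ℤ) + 3).toNat = n + 3 := by omega
    simp only [M, add_zero, hsucc_one, hadd_three, hpred, Int.toNat_natCast]
    push_cast
    ring

end Recursion

section Iterate

variable {q : ℂ}

lemma natCast_mul_pow_pred_mul (n : ℕ) (X : ℂ) : (n : ℂ) * X ^ (n - 1) * X = n * X ^ n := by
  rcases n with _ | n
  · simp
  · rw [Nat.add_sub_cancel, mul_assoc, ← pow_succ]

lemma D_monomial (hq : ‖q‖ < 1) (α β γ : ℕ) :
    D (fun z => Eis 1 z ^ α * G2 z ^ β * Eis 2 z ^ γ) q =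
      (2 * α + 4 * β + 8 * γ) / 24 * (Eis 1 q ^ (α + 1) * G2 q ^ β * Eis 2 q ^ γ)
      + (24 * γ - 8 * β) / 24 * (Eis 1 q ^ α * G2 q ^ (β + 1) * Eis 2 q ^ γ)
      - α / 12 * (Eis 1 q ^ (α - 1) * G2 q ^ β * Eis 2 q ^ (γ + 1))
      + β / 6 * (Eis 1 q ^ α * G2 q ^ (β - 1) * Eis 2 q ^ (γ + 1))
      - 4 * γ / 3 * (Eis 1 q ^ α * G2 q ^ (β + 3) * Eis 2 q ^ (γ - 1)) := by
  have hE := (analyticAt_Eis_one hq).differentiableAt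
  have hG := (analyticAt_G2 hq).differentiableAt
  have hF := (analyticAt_Eis_two hq).differentiableAt
  rw [D_mul ((hE.fun_pow α).fun_mul (hG.fun_pow β)) (hF.fun_pow γ),
    D_mul (hE.fun_pow α) (hG.fun_pow β), D_pow hE, D_pow hG, D_pow hF,
    D_Eis_one hq, D_G2 hq, D_Eis_two hq]
  have hα := natCast_mul_pow_pred_mul α (Eis 1 q)
  have hβ := natCast_mul_pow_pred_mul β (G2 q)
  have hγ := natCast_mul_pow_pred_mul γ (Eis 2 q)
  linear_combination Eis 1 q / 12 * G2 q ^ β * Eis 2 q ^ γ * hα +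
    Eis 1 q ^ α * Eis 2 q ^ γ * (Eis 1 q / 6 - G2 q / 3) * hβ +
    Eis 1 q ^ α * G2 q ^ β * (Eis 1 q / 3 + G2 q) * hγ

lemma differentiableAt_monomial (hq : ‖q‖ < 1) (α β γ : ℕ) :
    DifferentiableAt ℂ (fun z => Eis 1 z ^ α * G2 z ^ β * Eis 2 z ^ γ) q :=
  ((((analyticAt_Eis_one hq).pow α).mul ((analyticAt_G2 hq).pow β)).mul
    ((analyticAt_Eis_two hq).pow γ)).differentiableAt

lemma differentiableAt_weightPoly (t : ℕ) (hq : ‖q‖ < 1) :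
    DifferentiableAt ℂ (fun z => weightPoly t (Eis 1 z) (G2 z) (Eis 2 z)) q := by
  simp only [weightPoly]
  exact DifferentiableAt.fun_sum fun x _ => (differentiableAt_monomial hq _ _ _).const_mul _

lemma D_weightPoly (t : ℕ) (hq : ‖q‖ < 1) :
    D (fun z => weightPoly t (Eis 1 z) (G2 z) (Eis 2 z)) q =
      weightPoly (t + 1) (Eis 1 q) (G2 q) (Eis 2 q) -
        (Eis 1 q - G2 q) / 24 * weightPoly t (Eis 1 q) (G2 q) (Eis 2 q) := by
  rw [weightPoly_succ]
  simp only [weightPoly]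
  rw [D_sum fun x _ => (differentiableAt_monomial hq _ _ _).const_mul _, mul_sum, ← sum_sub_distrib]
  refine sum_congr rfl fun x _ => ?_
  rw [D_const_mul, D_monomial hq]
  ring

theorem D_iterate_theta4 (t : ℕ) (hq : ‖q‖ < 1) :
    (D^[t] theta4) q = theta4 q * weightPoly t (Eis 1 q) (G2 q) (Eis 2 q) := by
  induction t generalizing q with
  | zero => simp [weightPoly_zero]
  | succ t ih =>
    rw [Function.iterate_succ_apply', D_congr (fun z hz => ih hz) hq,
      D_mul (analyticAt_theta4 hq).differentiableAt (differentiableAt_weightPoly t hq),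
      D_weightPoly t hq, D_theta4 hq]
    ring

end Iterate

end

end QuasiTheta

theorem theorem5p1 (t : ℕ) (ht : 0 < t) (q : ℂ) (hq : ‖q‖ < 1) :
    QuasiTheta.G2 q = QuasiTheta.Theta 0 1 q ∧
    QuasiTheta.theta4 q ≠ 0 ∧
    (QuasiTheta.D^[t] QuasiTheta.theta4) q / QuasiTheta.theta4 q =
      ∑ x ∈ (Finset.range (t + 1) ×ˢ Finset.range (t + 1) ×ˢ Finset.range (t + 1)).filter
          (fun x : ℕ × ℕ × ℕ => x.1 + x.2.1 + 2 * x.2.2 = t),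
        ((QuasiTheta.cTilde x.1 x.2.1 x.2.2 : ℚ) : ℂ) *
          QuasiTheta.Eis 1 q ^ x.1 * QuasiTheta.G2 q ^ x.2.1 * QuasiTheta.Eis 2 q ^ x.2.2 := by
  refine ⟨QuasiTheta.G2_eq_Theta hq, QuasiTheta.theta4_ne_zero hq, ?_⟩
  rw [QuasiTheta.D_iterate_theta4 t hq, mul_div_cancel_left₀ _ (QuasiTheta.theta4_ne_zero hq)]
  exact Finset.sum_congr rfl fun x _ => by ring
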